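/- Let $(\Lambda,\mathcal E)$ be a finite simple graph, $S\in\{0,1,2,\dots\}$, $u\in[0,1]$, $\beta\ge 0$. On $\bigotimes_{x\in\Lambda}\mathbb C^{2S+1}$, with basis $|\sigma\rangle$, $\sigma\in\{-S,\dots,S\}^{\Lambda}$, consider $$\tilde H=-\sum_{\{x,y\}\in\mathcal E}\bigl(u\,T_{xy}+(1-u)P_{xy}-1\bigr),$$ where $T_{xy}|a,b\rangle=|b,a\rangle$ and $\langle a,b|P_{xy}|c,d\rangle=(-1)^{a-c}\delta_{a,-b}\delta_{c,-d}$. Let $\tilde Z=\operatorname{Tr}e^{-\beta\tilde H}$ and $\langle O\rangle^{\sim}=\tilde Z^{-1}\operatorname{Tr}(O\,e^{-\beta\tilde H})$. Let $S^1,S^2,S^3$ be the standard spin-$S$ operators on $\mathbb C^{2S+1}$ ($S^3|a\rangle=a|a\rangle$, $(S^1+iS^2)|a\rangle=\sqrt{S(S+1)-a(a+1)}\,|a+1\rangle$, $S^1$ and $S^2$ Hermitian). For an operator $A$ on $\mathbb C^{2S+1}$ write $A_x=A\otimes\mathrm{Id}_{\Lambda\setminus\{x\}}$, and write $\operatorname{tr}$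 for the trace on $\mathbb C^{2S+1}$. Let $\rho$ be the law of independent Poisson point processes on $\mathcal E\times[0,\beta]$, of crosses with intensity $u$ and of double bars with intensity $1-u$. Given a realization $\omega$, the loops in $\Lambda\times[0,\beta]_{\rm per}$ (the time $\beta$ is identified with the time $0$) are followed along the vertical lines; at a transition at $\{x,y\}$ one moves to the other site of the edge, and continues in the same vertical direction at a cross, and in the opposite vertical direction at a double bar. Let $\mathcal L(\omega)$ be the set of loops. Let $E^+_{x,y}$ (resp. $E^-_{x,y}$) be the event that $(x,0)$ and $(y,0)$ belong to the same loop, with identical (resp. opposite) vertical directions at these points, $E_{x,y}=E^+_{x,y}\cup E^-_{x,y}$, and $$\tilde{\mathbb P}(E)=\frac1{\tilde Z}\int 1_E(\omega)\,(2S+1)^{|\mathcal L(\omega)|}\,\rho(\mathrm d\omega).$$ Then, for all $x\ne y$ in $\Lambda$, $\tilde Z\neq0$ and, for all operators $A,B$ on $\mathbb C^{2S+1}$, $$\begin{split}\langle A_xB_y\rangle^{\sim}=&\tfrac1{2S+1}(\operatorname{tr}AB)\,\tilde{\mathbb P}(E^+_{x,y})+\tfrac1{2S+1}\Bigl(\sum_{a,b=-S}^{S}(-1)^{a+b}\langle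 a|A|b\rangle\langle-a|B|-b\rangle\Bigr)\tilde{\mathbb P}(E^-_{x,y})\\&+\tfrac1{(2S+1)^2}(\operatorname{tr}A)(\operatorname{tr}B)\,\tilde{\mathbb P}(E^{\rm c}_{x,y}).\end{split}$$ Moreover, for $i=1,2,3$, $$\langle S^i_xS^i_y\rangle^{\sim}=\tfrac13S(S+1)\bigl[\tilde{\mathbb P}(E^+_{x,y})-\tilde{\mathbb P}(E^-_{x,y})\bigr],$$ $$\langle(S^i_x)^2(S^i_y)^2\rangle^{\sim}-\langle(S^i_x)^2\rangle^{\sim}\langle(S^i_y)^2\rangle^{\sim}=\tfrac1{45}S(S+1)(2S-1)(2S+3)\,\tilde{\mathbb P}(E_{x,y}).$$ -/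

import Mathlib

open MeasureTheory
open scoped ENNReal Nat Matrix

noncomputable section

namespace SpinLoop

/-! ### Spins and spin operators -/

/-- The spin values `-S, -S+1, …, S` for an integer spin `S`. -/
abbrev Spin (S : ℕ) : Type := {a : ℤ // a ∈ Finset.Icc (-(S : ℤ)) (S : ℤ)}

/-- The opposite spin value. -/
def Spin.opp {S : ℕ} (a : Spin S) : Spin S :=
  ⟨-a.1, by have h := Finset.mem_Icc.1 a.2; exact Finset.mem_Icc.2 ⟨by omega, by omega⟩⟩

/-- Operators on `ℂ^{2S+1}`, as matrices in the basis `|a⟩`; the entry `A a b` is `⟨a|A|b⟩`. -/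
abbrev SiteOp (S : ℕ) : Type := Matrix (Spin S) (Spin S) ℂ

/-- The raising operator, `S⁺ |b⟩ = √(S(S+1) - b(b+1)) |b+1⟩`. -/
def raising (S : ℕ) : SiteOp S := Matrix.of fun a b =>
  if a.1 = b.1 + 1 then
    ((Real.sqrt ((S : ℝ) * (S + 1) - (b.1 : ℝ) * (b.1 + 1)) : ℝ) : ℂ) else 0

/-- The spin operators `S¹, S², S³` (indexed by `0, 1, 2`) in the basis where `S³` is diagonal:
`S¹ = (S⁺ + S⁻)/2`, `S² = (S⁺ - S⁻)/(2i)`, where `S⁻` is the adjoint of `S⁺`. -/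
def spinOp (S : ℕ) : Fin 3 → SiteOp S :=
  ![(1 / 2 : ℂ) • (raising S + (raising S)ᴴ),
    (1 / (2 * Complex.I) : ℂ) • (raising S - (raising S)ᴴ),
    Matrix.diagonal fun a => ((a.1 : ℤ) : ℂ)]

/-! ### The quantum spin system on a graph -/

section Quantum

variable {Λ : Type*} [Fintype Λ] [DecidableEq Λ]

/-- Operators on `⨂_{x ∈ Λ} ℂ^{2S+1}`, as matrices in the basis of classical configurations
`σ : Λ → {-S, …, S}`. -/
abbrev ManyOp (Λ : Type*) (S : ℕ) : Type _ := Matrix (Λ → Spin S) (Λ → Spin S) ℂ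

/-- The operator `A_x = A ⊗ Id` on all sites but `x`. -/
def onSite {S : ℕ} (x : Λ) (A : SiteOp S) : ManyOp Λ S := Matrix.of fun σ τ =>
  if ∀ z, z ≠ x → σ z = τ z then A (σ x) (τ x) else 0

/-- Extension to `Λ` of a two-site operator with matrix elements `⟨a,b| M |c,d⟩ = M a b c d`,
acting on the sites `x, y`. -/
def onPair {S : ℕ} (M : Spin S → Spin S → Spin S → Spin S → ℂ) (x y : Λ) : ManyOp Λ S :=
  Matrix.of fun σ τ =>
    if ∀ z, z ≠ x → z ≠ y → σ z = τ z then M (σ x) (σ y) (τ x) (τ y) else 0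

/-- Matrix elements of the transposition: `T |c,d⟩ = |d,c⟩`. -/
def transElem (S : ℕ) (a b c d : Spin S) : ℂ := if a = d ∧ b = c then 1 else 0

/-- Matrix elements `⟨a,b| P |c,d⟩ = (-1)^{a-c} δ_{a,-b} δ_{c,-d}`. -/
def singletElem (S : ℕ) (a b c d : Spin S) : ℂ :=
  if a = b.opp ∧ c = d.opp then (-1 : ℂ) ^ (a.1 - c.1) else 0

theorem onPair_comm {S : ℕ} (M : Spin S → Spin S → Spin S → Spin S → ℂ)
    (hM : ∀ a b c d, M a b c d = M b a d c) (x y : Λ) : onPair M x y = onPair M y x := by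
  ext σ τ
  simp only [onPair, Matrix.of_apply]
  rw [hM]
  have h : (∀ z, z ≠ x → z ≠ y → σ z = τ z) ↔ (∀ z, z ≠ y → z ≠ x → σ z = τ z) :=
    ⟨fun h z h₁ h₂ => h z h₂ h₁, fun h z h₁ h₂ => h z h₂ h₁⟩
  simp only [h]

theorem transElem_comm (S : ℕ) (a b c d : Spin S) :
    transElem S a b c d = transElem S b a d c := by
  simp only [transElem, and_comm]

theorem singletElem_comm (S : ℕ) (a b c d : Spin S) :
    singletElem S a b c d = singletElem S b a d c := by
  simp only [singletElem, Spin.opp, Subtype.ext_iff]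
  by_cases h : a.1 = -b.1 ∧ c.1 = -d.1
  · have h' : b.1 = -a.1 ∧ d.1 = -c.1 := ⟨by omega, by omega⟩
    rw [if_pos h, if_pos h', h'.1, h'.2,
      show -a.1 - -c.1 = -(a.1 - c.1) by ring, zpow_neg, ← inv_zpow]
    norm_num
  · have h' : ¬ (b.1 = -a.1 ∧ d.1 = -c.1) := fun h' => h ⟨by omega, by omega⟩
    rw [if_neg h, if_neg h']

/-- The operator `T_{xy}` attached to the unordered pair `{x,y}`. -/
def transOp (S : ℕ) (e : Sym2 Λ) : ManyOp Λ S :=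
  Sym2.lift ⟨fun x y => onPair (transElem S) x y, onPair_comm _ (transElem_comm S)⟩ e

/-- The operator `P_{xy}` attached to the unordered pair `{x,y}`. -/
def singletOp (S : ℕ) (e : Sym2 Λ) : ManyOp Λ S :=
  Sym2.lift ⟨fun x y => onPair (singletElem S) x y, onPair_comm _ (singletElem_comm S)⟩ e

/-- The Hamiltonian
`H̃ = - ∑_{{x,y} ∈ E} (u T_{xy} + (1-u) P_{xy} - 1) - ∑_x h_x S³_x`. -/
def hamiltonian (G : SimpleGraph Λ) [DecidableRel G.Adj] (S : ℕ) (u : ℝ) (h : Λ → ℝ) :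
    ManyOp Λ S :=
  - (∑ e ∈ G.edgeFinset, ((u : ℂ) • transOp S e + ((1 - u : ℝ) : ℂ) • singletOp S e - 1))
  - ∑ x, (h x : ℂ) • onSite x (spinOp S 2)

/-- The Gibbs operator `e^{-β H̃}`. -/
def gibbs (G : SimpleGraph Λ) [DecidableRel G.Adj] (S : ℕ) (u β : ℝ) (h : Λ → ℝ) : ManyOp Λ S :=
  NormedSpace.exp ((-β : ℂ) • hamiltonian G S u h)

/-- The partition function `Z̃ = Tr e^{-β H̃}`. -/
def partitionFunction (G : SimpleGraph Λ) [DecidableRel G.Adj] (S : ℕ) (u β : ℝ) (h : Λ → ℝ) : ℂ :=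
  (gibbs G S u β h).trace

/-- The thermal expectation `⟨O⟩~ = Z̃⁻¹ Tr (O e^{-β H̃})` at zero external field. -/
def expect (G : SimpleGraph Λ) [DecidableRel G.Adj] (S : ℕ) (u β : ℝ) (O : ManyOp Λ S) : ℂ :=
  1 / partitionFunction G S u β 0 * (O * gibbs G S u β 0).trace

end Quantum

/-! ### Poisson point processes -/

/-- The law of the Poisson point process with finite intensity measure `μ`, on finite families of
points `(n, (ω₀, …, ω_{n-1}))`: on families of `n` points it is `e^{-μ(X)} μ^{⊗ n} / n!`, that is,
the number of points is Poisson with mean `μ(X)` and, given their number, the points are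
independent with law `μ / μ(X)`. (The labelling of the points is immaterial.) -/
def poissonLaw {X : Type*} [MeasurableSpace X] (μ : Measure X) :
    Measure (Σ n : ℕ, (Fin n → X)) :=
  Measure.sum fun n : ℕ =>
    ENNReal.ofReal (Real.exp (-(μ Set.univ).toReal) / (n ! : ℝ)) •
      (Measure.pi fun _ : Fin n => μ).map (fun v => ⟨n, v⟩)

/-- The two kinds of transitions. -/
inductive Kind : Type
  | cross
  | doubleBar

instance : MeasurableSpace Kind := ⊤

instance {Λ : Type*} (G : SimpleGraph Λ) : MeasurableSpace G.edgeSet := ⊤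

/-- A transition: its edge, its kind and its time. -/
abbrev Event {Λ : Type*} (G : SimpleGraph Λ) : Type _ := G.edgeSet × Kind × ℝ

/-- A realization: a finite family of transitions. -/
abbrev Realization {Λ : Type*} (G : SimpleGraph Λ) : Type _ := Σ n : ℕ, (Fin n → Event G)

/-- The intensity: on each edge, crosses with rate `u` and double bars with rate `1 - u`
on `[0, β]`. -/
def intensity {Λ : Type*} (G : SimpleGraph Λ) (u β : ℝ) : Measure (Event G) :=
  (Measure.count : Measure G.edgeSet).prod
    ((ENNReal.ofReal u • Measure.dirac Kind.cross
        + ENNReal.ofReal (1 - u) • Measure.dirac Kind.doubleBar).prod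
      (volume.restrict (Set.Icc 0 β)))

/-- The measure `ρ` on realizations. -/
def rho {Λ : Type*} (G : SimpleGraph Λ) (u β : ℝ) : Measure (Realization G) :=
  poissonLaw (intensity G u β)

/-! ### Loops -/

section Loops

variable {Λ : Type*} {G : SimpleGraph Λ}

/-- The `k`-th transition of `ω` in the order of increasing times `t₁ < … < t_n`
(the index `k` runs from `0`; coinciding times have probability zero). -/
def nthEvent (ω : Realization G) (k : Fin ω.1) : Event G :=
  ω.2 (Tuple.sort (fun i => (ω.2 i).2.2) k)

/-- The edge of the `k`-th transition. -/
def nthEdge (ω : Realization G) (k : Fin ω.1) : Sym2 Λ := (nthEvent ω k).1.1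

/-- The kind of the `k`-th transition. -/
def nthKind (ω : Realization G) (k : Fin ω.1) : Kind := (nthEvent ω k).2.1

/-- Vertical pieces of the loops. The transition times `0 = t₀ < t₁ < … < t_n < t_{n+1} = β` cut
the vertical lines of `Λ × [0, β]`; `(x, k)` stands for `{x} × (t_k, t_{k+1})`, `k = 0, …, n`. -/
abbrev Piece (ω : Realization G) : Type _ := Λ × Fin (ω.1 + 1)

/-- Vertical pieces with a vertical direction (`true` is up, `false` is down). -/
abbrev DirPiece (ω : Realization G) : Type _ := Piece ω × Bool

/-- Two directed pieces are linked when one comes directly after the other along a loop that is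
travelled in the given directions (in one or the other order). The transition `k` separates the
pieces `k.castSucc` (below) and `k.succ` (above). -/
inductive Link (ω : Realization G) : DirPiece ω → DirPiece ω → Prop
  /-- sites that do not take part in the transition: the vertical line continues -/
  | through (k : Fin ω.1) (z : Λ) (d : Bool) (hz : z ∉ nthEdge ω k) :
      Link ω ((z, k.castSucc), d) ((z, k.succ), d)
  /-- cross: move to the other site, keep the vertical direction -/
  | cross (k : Fin ω.1) (x y : Λ) (d : Bool) (he : nthEdge ω k = s(x, y))
      (hk : nthKind ω k = Kind.cross) :
      Link ω ((x, k.castSucc), d) ((y, k.succ), d)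
  /-- double bar, from below: move to the other site, reverse the vertical direction -/
  | barBelow (k : Fin ω.1) (x y : Λ) (d : Bool) (he : nthEdge ω k = s(x, y))
      (hk : nthKind ω k = Kind.doubleBar) :
      Link ω ((x, k.castSucc), d) ((y, k.castSucc), !d)
  /-- double bar, from above: move to the other site, reverse the vertical direction -/
  | barAbove (k : Fin ω.1) (x y : Λ) (d : Bool) (he : nthEdge ω k = s(x, y))
      (hk : nthKind ω k = Kind.doubleBar) :
      Link ω ((x, k.succ), d) ((y, k.succ), !d)
  /-- time is periodic: the top and the bottom of each vertical line are joined -/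
  | periodic (x : Λ) (d : Bool) : Link ω ((x, Fin.last ω.1), d) ((x, 0), d)

/-- Directed pieces belonging to the same loop, travelled in one direction. -/
def SameDirLoop (ω : Realization G) : DirPiece ω → DirPiece ω → Prop :=
  Relation.EqvGen (Link ω)

/-- The set `𝓛(ω)` of loops: pieces modulo the equivalence relation generated by being linked. -/
def LoopSet (ω : Realization G) : Type _ :=
  Quot fun p q : Piece ω => ∃ d d' : Bool, Link ω (p, d) (q, d')

/-- The number of loops `|𝓛(ω)|`. -/
def numLoops (ω : Realization G) : ℕ := Nat.card (LoopSet ω)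

variable (G)

/-- `E⁺_{x,y}`: `(x,0)` and `(y,0)` are on the same loop, with identical vertical directions. -/
def eventPlus (x y : Λ) : Set (Realization G) :=
  {ω | SameDirLoop ω ((x, 0), true) ((y, 0), true)}

/-- `E⁻_{x,y}`: `(x,0)` and `(y,0)` are on the same loop, with opposite vertical directions. -/
def eventMinus (x y : Λ) : Set (Realization G) :=
  {ω | SameDirLoop ω ((x, 0), true) ((y, 0), false)}

/-- `E_{x,y} = E⁺_{x,y} ∪ E⁻_{x,y}`: `(x,0)` and `(y,0)` are on the same loop. -/
def eventSame (x y : Λ) : Set (Realization G) := eventPlus G x y ∪ eventMinus G x y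

/-- `P̃(E) = Z̃⁻¹ ∫ 1_E(ω) (2S+1)^{|𝓛(ω)|} ρ(dω)`, where `Z̃ = Tr e^{-β H̃}` at zero field. -/
def loopProb [Fintype Λ] [DecidableEq Λ] [DecidableRel G.Adj] (S : ℕ) (u β : ℝ)
    (E : Set (Realization G)) : ℂ :=
  1 / partitionFunction G S u β 0 *
    ((∫ ω, E.indicator (fun ω => ((2 * S + 1 : ℝ)) ^ numLoops ω) ω ∂(rho G u β) : ℝ) : ℂ)

end Loops

end SpinLoop

end

set_option linter.unusedSectionVars false

noncomputable section

namespace SpinLoop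

/-! ### Cycles of a permutation with a reversal, cut at two points. -/

section Cycles

variable {D : Type*} [Finite D] {s : Equiv.Perm D} {r : D → D}

/-! The Hamiltonian is a sum of transition operators plus a constant. Hence the exponential series
of the Gibbs operator is a sum over words of edges and kinds, weighted by their rates and by `β ^ n
/ n!`. Integrating against the Poisson law a function that sees only the order of the transitions
gives the same series, with the same factor `exp (-|E| β)`. The theorem thus reduces to one word at
a time: the trace of `A_x B_y` times a product of transition operators must be the loop weight times
the coefficient of the event that occurs (`trace_eq_loopWeight`).

For a fixed word, the trace is a sum over spins on the vertical pieces. A nonzero term requires the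
spin to be constant along each loop, up to a change of sign where the vertical direction turns
(`Spin.dir`). The signs of the double bars are controlled by orienting the loops: each matrix
element is the product of `upSign` over the pieces below and above it (`transitionOp_apply`), so the
signs cancel in pairs except next to time `0` at `x` and `y` (`trace_mul_transitionProd`).

The operators `A` and `B` cut the loops at `(x,0)` and `(y,0)`. Two arcs with independent spins
remain. On different loops each arc joins a site to itself, giving `tr A * tr B`; with equal
directions the arcs join `x` to `y` crosswise, giving `tr (A B)`; with opposite directions they join
bottom to bottom and top to top with flipped spins, giving the signed sum. The power of `2S+1` is
found by putting `A = B = 1`, where the trace counts loops (`trace_one_mul_transitionProd`).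

For spin operators, spin flip with signs and transposition reverses the sign (`spinOp_opp`), and
commutators give the traces of `(Sⁱ)²` and `(Sⁱ)⁴` from those of the diagonal `S³`. -/

theorem not_sameCycle_reverse (hs : ∀ a, s (r (s a)) = r a)
    (h0 : ∀ a, r a ≠ a) (h1 : ∀ a, s a ≠ r a) (a : D) : ¬ s.SameCycle a (r a) := by
  -- A path from `a` to `r a` loses one step at each end by `s r s = r`. Its middle would be a fixed
  -- point of `r` or a point where `s` and `r` agree.
  have key : ∀ m : ℕ, ∀ a, (s ^ m) a ≠ r a := by
    intro m
    induction m using Nat.strong_induction_on with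
    | _ m ih =>
      intro a h
      rcases m with _ | _ | m
      · exact h0 a (by simpa using h.symm)
      · exact h1 a (by simpa using h)
      · apply ih m (by omega) (s a)
        have h2 : s ((s ^ m) (s a)) = r a := by
          rw [← h, pow_succ', pow_succ]; rfl
        rw [← hs a] at h2
        exact s.injective h2
  intro h
  obtain ⟨m, -, hm⟩ := h.exists_pow_eq'
  exact key m a hm

/-- The steps of `s` that remain when the ones into `p`, `q` and out of `r p`, `r q` are removed. -/
def CutStep (s : Equiv.Perm D) (r : D → D) (p q a b : D) : Prop :=
  b = s a ∧ (b ≠ p ∧ b ≠ q) ∧ (a ≠ r p ∧ a ≠ r q)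

/-- Walk from `p` along `s` and stop just before the first arrival at `p` or `q`: `z` is the last
point and `A` the set visited. As `r p` and `r q` are off the cycle of `p`, every step of the walk
survives the cut. -/
theorem exists_arc (p q : D) (hp : ¬ s.SameCycle p (r p)) (hq : ¬ s.SameCycle p (r q)) :
    ∃ z, ∃ A : Set D, (s z = p ∨ s z = q) ∧ Relation.EqvGen (CutStep s r p q) p z ∧
      (∀ a ∈ A, s.SameCycle p a) ∧ p ∈ A ∧ (∀ a ∈ A, a ≠ z → s a ∈ A) ∧
      (∀ a, s a ∈ A → s a ≠ p → a ∈ A) ∧ (q ≠ p → q ∉ A) := by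
  classical
  -- The exponent `m + 1` keeps the start from counting as an arrival.
  have hex : ∃ m : ℕ, (s ^ (m + 1)) p = p ∨ (s ^ (m + 1)) p = q := by
    refine ⟨orderOf s - 1, Or.inl ?_⟩
    rw [Nat.sub_add_cancel (orderOf_pos s), pow_orderOf_eq_one]; rfl
  have hmin := fun i => Nat.find_min hex (m := i)
  have hm := Nat.find_spec hex
  set m := Nat.find hex
  have hsucc : ∀ i, (s ^ (i + 1)) p = s ((s ^ i) p) := fun i => by rw [pow_succ']; rfl
  refine ⟨(s ^ m) p, {a | ∃ i ≤ m, (s ^ i) p = a}, ?_, ?_, ?_, ⟨0, by simp, rfl⟩, ?_, ?_, ?_⟩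
  · rwa [← hsucc]
  · have : ∀ i ≤ m, Relation.EqvGen (CutStep s r p q) p ((s ^ i) p) := by
      intro i
      induction i with
      | zero => intro _; exact .refl _
      | succ i ih =>
        intro hi
        refine .trans _ _ _ (ih (by omega)) (.rel _ _ ⟨hsucc i, ?_, ?_⟩)
        · simpa using hmin i (by omega)
        · exact ⟨fun h => hp ⟨i, by simpa using h⟩, fun h => hq ⟨i, by simpa using h⟩⟩
    exact this m le_rfl
  · rintro _ ⟨i, -, rfl⟩
    exact ⟨i, by simp⟩
  · rintro _ ⟨i, hi, rfl⟩ hne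
    refine ⟨i + 1, ?_, hsucc i⟩
    rcases hi.lt_or_eq with h | h
    · exact h
    · exact absurd (by rw [h]) hne
  · rintro a ⟨i, hi, h⟩ hne
    match i, hi, h with
    | 0, _, h => exact absurd h.symm hne
    | i + 1, hi, h =>
      rw [hsucc] at h
      exact ⟨i, by omega, s.injective h⟩
  · rintro hne ⟨i, hi, h⟩
    match i, hi, h with
    | 0, _, h => exact hne h.symm
    | i + 1, hi, h => exact hmin i (by omega) (Or.inr h)

theorem cut_connected_of_not_sameCycle (p q : D) (hp : ¬ s.SameCycle p (r p))
    (hq : ¬ s.SameCycle p (r q)) (hpq : ¬ s.SameCycle p q) :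
    Relation.EqvGen (CutStep s r p q) p (s.symm p) := by
  obtain ⟨z, A, hz, hc, hA, hpA, hf, hb, hqA⟩ := exists_arc p q hp hq
  have hpz : s.SameCycle p z := by
    rcases hz with h | h
    · exact ⟨-1, by rw [← h]; simp⟩
    · exfalso
      have : ∀ x y, Relation.EqvGen (CutStep s r p q) x y → s.SameCycle x y := by
        intro x y h
        induction h with
        | rel x y h => exact ⟨1, by simpa using h.1.symm⟩
        | refl => rfl
        | symm _ _ _ ih => exact ih.symm
        | trans _ _ _ _ _ i j => exact i.trans j
      exact hpq ((this _ _ hc).trans ⟨1, by simpa using h⟩)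
  rcases hz with h | h
  · rwa [show s.symm p = z by rw [← h, Equiv.symm_apply_apply]]
  · exact absurd (hpz.trans ⟨1, by simpa using h⟩) hpq

theorem cut_connected_of_sameCycle (p q : D) (hne : p ≠ q) (hp : ¬ s.SameCycle p (r p))
    (hq : ¬ s.SameCycle p (r q)) (hpq : s.SameCycle p q) :
    Relation.EqvGen (CutStep s r p q) p (s.symm q) := by
  obtain ⟨z, A, hz, hc, hA, hpA, hf, hb, hqA⟩ := exists_arc p q hp hq
  rcases hz with h | h
  -- If the walk closed up at `p`, then `A` would be stable under `s` and contain the whole cycle,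
  -- in particular `q`.
  · exfalso
    obtain ⟨i, -, hi⟩ := hpq.exists_pow_eq'
    have : ∀ i : ℕ, (s ^ i) p ∈ A := by
      intro i
      induction i with
      | zero => exact hpA
      | succ i ih =>
        rw [pow_succ', Equiv.Perm.mul_apply]
        by_cases hz : (s ^ i) p = z
        · rw [hz, h]; exact hpA
        · exact hf _ ih hz
    exact hqA hne.symm (by rw [← hi]; exact this i)
  · rwa [show s.symm q = z by rw [← h, Equiv.symm_apply_apply]]

/-- A cycle that is cut twice falls into two arcs. -/
theorem exists_closed_separating (hr : ∀ a, r (r a) = a) (hs : ∀ a, s (r (s a)) = r a)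
    (p q : D) (hne : p ≠ q) (hp : ¬ s.SameCycle p (r p)) (hq : ¬ s.SameCycle p (r q)) :
    ∃ C : Set D, (∀ a, r a ∈ C ↔ a ∈ C) ∧ (∀ a b, CutStep s r p q a b → (a ∈ C ↔ b ∈ C)) ∧
      p ∈ C ∧ q ∉ C := by
  obtain ⟨z, A, hz, hc, hA, hpA, hf, hb, hqA⟩ := exists_arc p q hp hq
  -- The arc together with its reversal. It misses `q`, since `q` is not visited and `r q` is off
  -- the cycle of `p`.
  refine ⟨{a | a ∈ A ∨ r a ∈ A}, ?_, ?_, Or.inl hpA, ?_⟩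
  · intro a
    simp only [Set.mem_ofPred_eq, hr]
    exact or_comm
  · rintro a b ⟨rfl, ⟨h1, h2⟩, h3, h4⟩
    have hrr : ∀ a b, a = r b → r a = b := fun a b h => by rw [h, hr]
    simp only [Set.mem_ofPred_eq]
    apply or_congr
    · refine ⟨fun h => hf a h ?_, fun h => hb a h h1⟩
      rintro rfl
      tauto
    · have hsr : s (r (s a)) = r a := hs a
      constructor
      · intro h
        refine hb _ (hsr ▸ h) ?_
        rw [hsr]
        exact fun h => h3 (by rw [← h, hr])
      · intro h
        rw [← hsr]
        refine hf _ h fun h' => ?_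
        rw [← h', hsr] at hz
        rcases hz with h | h
        · exact h3 (by rw [← h, hr])
        · exact h4 (by rw [← h, hr])
  · rintro (h | h)
    · exact hqA hne.symm h
    · exact hq (hA _ h)

end Cycles

/-- An orientation of the loops. -/
theorem exists_orientation {P : Type*} [Finite P] (s : Equiv.Perm (P × Bool))
    (hs : ∀ a, s ((s a).1, !(s a).2) = (a.1, !a.2))
    (h : ∀ a : P × Bool, ¬ s.SameCycle a (a.1, !a.2)) :
    ∃ o : P → Bool, ∀ a b, s.SameCycle a b → xor (o a.1) a.2 = xor (o b.1) b.2 := by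
  classical
  have hrev1 : ∀ a, s.SameCycle ((s a).1, !(s a).2) (a.1, !a.2) :=
    fun a => ⟨1, by simpa using hs a⟩
  have hrevn : ∀ (n : ℕ) (a : P × Bool),
      s.SameCycle (((s ^ n) a).1, !((s ^ n) a).2) (a.1, !a.2) := by
    intro n
    induction n with
    | zero => intro a; rfl
    | succ n ih =>
      intro a
      rw [pow_succ, Equiv.Perm.mul_apply]
      exact (ih (s a)).trans (hrev1 a)
  have hrev : ∀ a b : P × Bool, s.SameCycle a b → s.SameCycle (a.1, !a.2) (b.1, !b.2) := by
    intro a b hab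
    obtain ⟨n, -, rfl⟩ := hab.exists_pow_eq'
    exact (hrevn n a).symm
  let R : Setoid P :=
    { r := fun p q => ∃ d, s.SameCycle (p, true) (q, d)
      iseqv :=
        { refl := fun p => ⟨true, Equiv.Perm.SameCycle.refl _ _⟩
          symm := by
            rintro p q ⟨d, hd⟩
            cases d
            · exact ⟨false, (hrev _ _ hd).symm⟩
            · exact ⟨true, hd.symm⟩
          trans := by
            rintro p q t ⟨d, hd⟩ ⟨e, he⟩
            cases d
            · exact ⟨!e, hd.trans (hrev _ _ he)⟩
            · exact ⟨e, hd.trans he⟩ } }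
  let rep : P → P := fun p => (Quotient.mk R p).out
  have hrep : ∀ p, ∃ d, s.SameCycle (p, true) (rep p, d) :=
    fun p => Setoid.symm (Quotient.mk_out (s := R) p)
  have hrepeq : ∀ a b : P × Bool, s.SameCycle a b → rep a.1 = rep b.1 := by
    rintro ⟨p, d⟩ ⟨q, e⟩ hab
    have : R p q := by
      cases d
      · exact ⟨!e, hrev _ _ hab⟩
      · exact ⟨e, hab⟩
    simp only [rep, Quotient.sound this]
  -- `o p` is the direction in which the representative of the loop is met when `p` is travelled
  -- upwards.
  choose o ho using hrep
  refine ⟨o, ?_⟩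
  have ho' : ∀ a : P × Bool, s.SameCycle a (rep a.1, !xor (o a.1) a.2) := by
    rintro ⟨p, d⟩
    cases d
    · have := hrev _ _ (ho p)
      simpa using this
    · simpa using ho p
  intro a b hab
  have h1 := (ho' a).symm.trans (hab.trans (ho' b))
  rw [hrepeq a b hab] at h1
  by_contra hne
  have h2 : (!xor (o b.1) b.2) = !(!xor (o a.1) a.2) := by
    revert hne
    cases xor (o a.1) a.2 <;> cases xor (o b.1) b.2 <;> simp
  rw [h2] at h1
  exact h _ h1

/-! ### Spin configurations that are consistent along loops -/

section Consistent

variable {S : ℕ}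

@[simp] theorem Spin.opp_opp (a : Spin S) : a.opp.opp = a := by
  simp [Spin.opp]

theorem card_spin (S : ℕ) : Fintype.card (Spin S) = 2 * S + 1 := by
  rw [Fintype.card_coe, Int.card_Icc]
  omega

/-- The spin value seen by a traveller that moves up (`true`) or down (`false`). -/
def Spin.dir (d : Bool) (a : Spin S) : Spin S := if d then a else a.opp

@[simp] theorem Spin.dir_true (a : Spin S) : Spin.dir true a = a := rfl

@[simp] theorem Spin.dir_false (a : Spin S) : Spin.dir false a = a.opp := rfl

@[simp] theorem Spin.dir_dir (d : Bool) (a : Spin S) : Spin.dir d (Spin.dir d a) = a := by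
  cases d <;> simp

theorem Spin.opp_inj {a b : Spin S} : a.opp = b.opp ↔ a = b :=
  ⟨fun h => by rw [← a.opp_opp, h, b.opp_opp], fun h => by rw [h]⟩

/-- The involution `Spin.dir d` as a permutation. -/
def Spin.dirEquiv (d : Bool) : Equiv.Perm (Spin S) :=
  ⟨Spin.dir d, Spin.dir d, Spin.dir_dir d, Spin.dir_dir d⟩

variable {P : Type*}

/-- The directed spin values do not change along the links `E`. -/
def Consistent (E : P × Bool → P × Bool → Prop) (f : P → Spin S) : Prop :=
  ∀ a b, E a b → Spin.dir a.2 (f a.1) = Spin.dir b.2 (f b.1)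

theorem Consistent.eqvGen {E : P × Bool → P × Bool → Prop} {f : P → Spin S}
    (hf : Consistent E f) {a b : P × Bool} (h : Relation.EqvGen E a b) :
    Spin.dir a.2 (f a.1) = Spin.dir b.2 (f b.1) := by
  induction h with
  | rel a b h => exact hf a b h
  | refl => rfl
  | symm _ _ _ ih => exact ih.symm
  | trans _ _ _ _ _ i j => exact i.trans j

/-- Pieces up to the links `E`, directions being forgotten. -/
abbrev LinkQuot (E : P × Bool → P × Bool → Prop) : Type _ :=
  Quot fun p q : P => ∃ d d' : Bool, E (p, d) (q, d')

theorem dir_eq_of_orient {o o' d d' : Bool} {a b : Spin S} (ho : xor o d = xor o' d') :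
    Spin.dir d a = Spin.dir d' b ↔ Spin.dir o a = Spin.dir o' b := by
  have h1 : a.opp = b ↔ a = b.opp := ⟨fun h => by rw [← h, a.opp_opp], fun h => by
    rw [h, b.opp_opp]⟩
  revert ho
  cases o <;> cases o' <;> cases d <;> cases d' <;> simp [Spin.opp_inj, h1]

/-- Consistent configurations are given by one spin for each loop. -/
def consistentEquiv (E : P × Bool → P × Bool → Prop) (o : P → Bool)
    (ho : ∀ a b, E a b → xor (o a.1) a.2 = xor (o b.1) b.2) :
    {f : P → Spin S // Consistent E f} ≃ (LinkQuot E → Spin S) where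
  toFun f := Quot.lift (fun p => Spin.dir (o p) (f.1 p)) (by
    rintro p q ⟨d, d', h⟩
    exact (dir_eq_of_orient (ho _ _ h)).1 (f.2 _ _ h))
  invFun g := ⟨fun p => Spin.dir (o p) (g (Quot.mk _ p)), by
    rintro ⟨p, d⟩ ⟨q, d'⟩ h
    rw [dir_eq_of_orient (ho _ _ h), Spin.dir_dir, Spin.dir_dir]
    exact congrArg g (Quot.sound ⟨d, d', h⟩)⟩
  left_inv f := by
    ext p
    simp
  right_inv g := by
    ext t
    induction t using Quot.ind
    simp

open scoped Classical in
theorem sum_consistent [Fintype P] [DecidableEq P] (E : P × Bool → P × Bool → Prop) [Fintype (LinkQuot E)] (o : P → Bool)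
    (ho : ∀ a b, E a b → xor (o a.1) a.2 = xor (o b.1) b.2) (wt : (P → Spin S) → ℂ) :
    ∑ f : P → Spin S, (if Consistent E f then wt f else 0) =
      ∑ g : LinkQuot E → Spin S, wt (fun p => Spin.dir (o p) (g (Quot.mk _ p))) := by
  rw [← Finset.sum_filter, ← Equiv.sum_comp (consistentEquiv E o ho).symm.symm,
    Finset.sum_subtype (p := fun f => Consistent E f)]
  · refine Finset.sum_congr rfl fun f _ => ?_
    congr 1
    exact (congrArg Subtype.val ((consistentEquiv E o ho).symm_apply_apply f)).symm
  · simp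

/-- All coordinates but `i` are free. The extra factor on the left avoids the exponent `card ι - 1`.
-/
theorem sum_eval_one {ι α : Type*} [Fintype ι] [DecidableEq ι] [Fintype α] (i : ι) (ψ : α → ℂ) :
    (Fintype.card α : ℂ) * ∑ g : ι → α, ψ (g i) =
      (Fintype.card α : ℂ) ^ Fintype.card ι * ∑ a, ψ a := by
  rw [← (Equiv.funSplitAt i α).symm.sum_comp, Fintype.sum_prod_type]
  simp only [Equiv.funSplitAt, Equiv.piSplitAt_symm_apply, dif_pos]
  simp only [Finset.sum_const, Finset.card_univ, Fintype.card_fun, nsmul_eq_mul,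
    ← Finset.mul_sum, Nat.cast_pow]
  have h : Fintype.card ι = Fintype.card {j // j ≠ i} + 1 := by
    have h1 := Fintype.card_subtype_compl (fun j => j = i)
    have h2 : 0 < Fintype.card ι := Fintype.card_pos_iff.2 ⟨i⟩
    simp only [Fintype.card_subtype_eq] at h1
    simp only [ne_eq]
    omega
  rw [h, pow_succ]
  ring

theorem sum_eval_two {ι α : Type*} [Fintype ι] [DecidableEq ι] [Fintype α] {i j : ι}
    (hij : i ≠ j) (wt : α → α → ℂ) :
    (Fintype.card α : ℂ) ^ 2 * ∑ g : ι → α, wt (g i) (g j) =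
      (Fintype.card α : ℂ) ^ Fintype.card ι * ∑ a, ∑ b, wt a b := by
  rw [← (Equiv.funSplitAt i α).symm.sum_comp, Fintype.sum_prod_type]
  simp only [Equiv.funSplitAt, Equiv.piSplitAt_symm_apply, dif_pos, hij.symm, dite_false]
  have h : Fintype.card ι = Fintype.card {j // j ≠ i} + 1 := by
    have h1 := Fintype.card_subtype_compl (fun j => j = i)
    have h2 : 0 < Fintype.card ι := Fintype.card_pos_iff.2 ⟨i⟩
    simp only [Fintype.card_subtype_eq] at h1
    simp only [ne_eq]
    omega
  rw [pow_two, mul_assoc, Finset.mul_sum,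
    Finset.sum_congr rfl fun a _ => sum_eval_one (⟨j, hij.symm⟩ : {j // j ≠ i}) (wt a),
    ← Finset.mul_sum, h, pow_succ]
  ring

open scoped Classical in
theorem sum_consistent_one [Fintype P] [DecidableEq P] (E : P × Bool → P × Bool → Prop) (o : P → Bool)
    (ho : ∀ a b, E a b → xor (o a.1) a.2 = xor (o b.1) b.2) :
    ∑ f : P → Spin S, (if Consistent E f then (1 : ℂ) else 0) =
      (2 * (S : ℂ) + 1) ^ Nat.card (LinkQuot E) := by
  have := Fintype.ofFinite (LinkQuot E)
  rw [sum_consistent E o ho, Finset.sum_const, Finset.card_univ, Fintype.card_fun, card_spin,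
    Nat.card_eq_fintype_card]
  simp

-- Each class carries one free spin and `X`, `Y` lie in different classes, so their spins are
-- independent. The orientation only reparametrizes the two sums by the involution `Spin.dir`.
open scoped Classical in
theorem sum_consistent_two [Fintype P] [DecidableEq P] (E : P × Bool → P × Bool → Prop) (o : P → Bool)
    (ho : ∀ a b, E a b → xor (o a.1) a.2 = xor (o b.1) b.2) (X Y : P)
    (hXY : (Quot.mk _ X : LinkQuot E) ≠ Quot.mk _ Y) (W : (P → Spin S) → ℂ)
    (wt : Spin S → Spin S → ℂ) (hW : ∀ f, Consistent E f → W f = wt (f X) (f Y)) :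
    (2 * (S : ℂ) + 1) ^ 2 *
        ∑ f : P → Spin S, (if Consistent E f then W f else 0) =
      (2 * (S : ℂ) + 1) ^ Nat.card (LinkQuot E) * ∑ a, ∑ b, wt a b := by
  have := Fintype.ofFinite (LinkQuot E)
  have hWw : ∀ f : P → Spin S, (if Consistent E f then W f else 0) =
      if Consistent E f then wt (f X) (f Y) else 0 := by
    intro f
    split_ifs with h
    · exact hW f h
    · rfl
  rw [Finset.sum_congr rfl fun f _ => hWw f, sum_consistent E o ho (fun f => wt (f X) (f Y))]
  have h := sum_eval_two hXY fun a b : Spin S => wt (Spin.dir (o X) a) (Spin.dir (o Y) b)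
  rw [card_spin] at h
  rw [Nat.card_eq_fintype_card]
  push_cast at h
  rw [h]
  congr 1
  refine (Equiv.sum_comp (Spin.dirEquiv (o X)) fun a => ∑ b, wt a (Spin.dir (o Y) b)).trans ?_
  refine Finset.sum_congr rfl fun a _ => ?_
  exact Equiv.sum_comp (Spin.dirEquiv (o Y)) fun b => wt a b

end Consistent

/-! ### Following the loops -/

section Step

variable {Λ : Type*} {G : SimpleGraph Λ} (ω : Realization G)

theorem nthEdge_not_isDiag (k : Fin ω.1) : ¬ (nthEdge ω k).IsDiag :=
  G.not_isDiag_of_mem_edgeSet (nthEvent ω k).1.2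

variable {ω} in
/-- Reversal of the direction. -/
def flip (a : DirPiece ω) : DirPiece ω := (a.1, !a.2)

@[simp] theorem flip_flip (a : DirPiece ω) : flip (flip a) = a := by simp [flip]

theorem flip_mk (p : Piece ω) (d : Bool) : flip ((p, d) : DirPiece ω) = (p, !d) := rfl

variable {ω} in
-- The cases are what the traveller runs into: a transition from below or from above, time `β`, or
-- time `0`.
theorem dirPiece_cases {motive : DirPiece ω → Prop}
    (up : ∀ (k : Fin ω.1) z, motive ((z, k.castSucc), true))
    (down : ∀ (k : Fin ω.1) z, motive ((z, k.succ), false))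
    (top : ∀ z, motive ((z, Fin.last _), true))
    (bottom : ∀ z, motive ((z, 0), false)) (a : DirPiece ω) : motive a := by
  obtain ⟨⟨z, k⟩, d⟩ := a
  cases d
  · induction k using Fin.cases with
    | zero => exact bottom z
    | succ k => exact down k z
  · induction k using Fin.lastCases with
    | last => exact top z
    | cast k => exact up k z

variable [DecidableEq Λ]

/-- The transposition of the two ends of an edge. -/
def edgeSwap (e : Sym2 Λ) : Equiv.Perm Λ :=
  Sym2.lift ⟨fun x y => Equiv.swap x y, fun x y => Equiv.swap_comm x y⟩ e

@[simp] theorem edgeSwap_mk (x y : Λ) : edgeSwap s(x, y) = Equiv.swap x y := rfl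

@[simp] theorem edgeSwap_edgeSwap (e : Sym2 Λ) (z : Λ) : edgeSwap e (edgeSwap e z) = z := by
  induction e with
  | _ x y => simp

theorem edgeSwap_of_notMem {e : Sym2 Λ} {z : Λ} (h : z ∉ e) : edgeSwap e z = z := by
  induction e with
  | _ x y =>
    simp only [Sym2.mem_iff, not_or] at h
    exact Equiv.swap_apply_of_ne_of_ne h.1 h.2

@[simp] theorem edgeSwap_mem {e : Sym2 Λ} {z : Λ} : edgeSwap e z ∈ e ↔ z ∈ e := by
  induction e with
  | _ x y =>
    simp only [edgeSwap_mk, Sym2.mem_iff, Equiv.swap_apply_eq_iff, Equiv.swap_apply_left,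
      Equiv.swap_apply_right]
    exact or_comm

theorem edgeSwap_ne {e : Sym2 Λ} (he : ¬ e.IsDiag) {z : Λ} (h : z ∈ e) : edgeSwap e z ≠ z := by
  induction e with
  | _ x y =>
    rw [Sym2.mk_isDiag_iff] at he
    rcases Sym2.mem_iff.1 h with rfl | rfl
    · simpa using Ne.symm he
    · simpa using he

theorem mk_edgeSwap {e : Sym2 Λ} {z : Λ} (h : z ∈ e) : e = s(z, edgeSwap e z) := by
  induction e with
  | _ x y =>
    rcases Sym2.mem_iff.1 h with rfl | rfl
    · simp
    · simp [Sym2.eq_swap]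

open scoped Classical in
/-- The successor of the piece below the transition `k`, travelled upwards. -/
def stepUp (k : Fin ω.1) (z : Λ) : DirPiece ω :=
  if nthKind ω k = Kind.doubleBar ∧ z ∈ nthEdge ω k then
    ((edgeSwap (nthEdge ω k) z, k.castSucc), false)
  else ((edgeSwap (nthEdge ω k) z, k.succ), true)

open scoped Classical in
/-- The successor of the piece above the transition `k`, travelled downwards. -/
def stepDown (k : Fin ω.1) (z : Λ) : DirPiece ω :=
  if nthKind ω k = Kind.doubleBar ∧ z ∈ nthEdge ω k then
    ((edgeSwap (nthEdge ω k) z, k.succ), true)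
  else ((edgeSwap (nthEdge ω k) z, k.castSucc), false)

/-- The piece that comes next along a loop. -/
def stepFun : DirPiece ω → DirPiece ω
  | ((z, k), true) =>
      Fin.lastCases (motive := fun _ => DirPiece ω) ((z, 0), true) (fun j => stepUp ω j z) k
  | ((z, k), false) =>
      Fin.cases (motive := fun _ => DirPiece ω) ((z, Fin.last _), false)
        (fun j => stepDown ω j z) k

@[simp] theorem stepFun_last (z : Λ) : stepFun ω ((z, Fin.last _), true) = ((z, 0), true) := by
  simp [stepFun]

@[simp] theorem stepFun_castSucc (k : Fin ω.1) (z : Λ) :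
    stepFun ω ((z, k.castSucc), true) = stepUp ω k z := by
  simp [stepFun]

@[simp] theorem stepFun_zero (z : Λ) :
    stepFun ω ((z, 0), false) = ((z, Fin.last _), false) := by
  simp [stepFun]

@[simp] theorem stepFun_succ (k : Fin ω.1) (z : Λ) :
    stepFun ω ((z, k.succ), false) = stepDown ω k z := by
  simp [stepFun]

/-- Turning round after a step and stepping again undoes the step. This makes `step` a bijection and
is the relation `s r s = r` of the cycle lemmas. -/
theorem stepFun_flip_stepFun (a : DirPiece ω) : stepFun ω (flip (stepFun ω a)) = flip a := by
  induction a using dirPiece_cases with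
  | up k z =>
    by_cases h : nthKind ω k = Kind.doubleBar ∧ z ∈ nthEdge ω k
    · simp [stepUp, flip_mk, h]
    · simp only [stepFun_castSucc, stepUp, flip_mk, if_neg h]
      simp [stepDown, h]
  | down k z =>
    by_cases h : nthKind ω k = Kind.doubleBar ∧ z ∈ nthEdge ω k
    · simp [stepDown, flip_mk, h]
    · simp only [stepFun_succ, stepDown, flip_mk, if_neg h]
      simp [stepUp, h]
  | top z => simp [flip_mk]
  | bottom z => simp [flip_mk]

/-- The permutation of directed pieces that follows the loops. -/
def step : Equiv.Perm (DirPiece ω) where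
  toFun := stepFun ω
  invFun a := flip (stepFun ω (flip a))
  left_inv a := by simp only [stepFun_flip_stepFun, flip_flip]
  right_inv a := by simp only [stepFun_flip_stepFun, flip_flip]

theorem step_apply (a : DirPiece ω) : step ω a = stepFun ω a := rfl

theorem step_flip_step (a : DirPiece ω) : step ω (flip (step ω a)) = flip a :=
  stepFun_flip_stepFun ω a

/-- The direction changes only at a double bar, and there the site changes too because an edge has
distinct ends. -/
theorem step_ne_flip (a : DirPiece ω) : step ω a ≠ flip a := by
  have key : ∀ k z, z ∈ nthEdge ω k → edgeSwap (nthEdge ω k) z ≠ z :=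
    fun k z h => edgeSwap_ne (nthEdge_not_isDiag ω k) h
  rw [step_apply]
  induction a using dirPiece_cases with
  | up k z =>
    by_cases h : nthKind ω k = Kind.doubleBar ∧ z ∈ nthEdge ω k
    · simp [stepUp, flip_mk, h, key k z h.2]
    · simp [stepUp, flip_mk, h]
  | down k z =>
    by_cases h : nthKind ω k = Kind.doubleBar ∧ z ∈ nthEdge ω k
    · simp [stepDown, flip_mk, h, key k z h.2]
    · simp [stepDown, flip_mk, h]
  | top z => simp [flip_mk]
  | bottom z => simp [flip_mk]

/-- Crossings of a transition or of time `β` are listed in `Link` from the lower piece to the next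
one in increasing time; a traveller going down uses them backwards. -/
theorem link_step (a : DirPiece ω) : Link ω a (step ω a) ∨ Link ω (step ω a) a := by
  have hc : ∀ k, nthKind ω k ≠ Kind.doubleBar → nthKind ω k = Kind.cross := by
    intro k h
    cases hk : nthKind ω k with
    | cross => rfl
    | doubleBar => exact absurd hk h
  rw [step_apply]
  induction a using dirPiece_cases with
  | up k z =>
    left
    by_cases hz : z ∈ nthEdge ω k
    · by_cases h : nthKind ω k = Kind.doubleBar
      · simpa [stepUp, hz, h] using Link.barBelow k z _ true (mk_edgeSwap hz) h
      · simpa [stepUp, hz, h] using Link.cross k z _ true (mk_edgeSwap hz) (hc k h)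
    · simpa [stepUp, hz, edgeSwap_of_notMem hz] using Link.through k z true hz
  | down k z =>
    by_cases hz : z ∈ nthEdge ω k
    · have hz' := mk_edgeSwap hz
      by_cases h : nthKind ω k = Kind.doubleBar
      · left
        simpa [stepDown, hz, h] using Link.barAbove k z _ false hz' h
      · right
        simpa [stepDown, hz, h] using
          Link.cross k _ z false (hz'.trans Sym2.eq_swap) (hc k h)
    · right
      simpa [stepDown, hz, edgeSwap_of_notMem hz] using Link.through k z false hz
  | top z => left; simpa using Link.periodic z true
  | bottom z => right; simpa using Link.periodic z false

theorem step_eq_of_link {a b : DirPiece ω} (h : Link ω a b) : step ω a = b ∨ step ω b = a := by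
  have hsw : ∀ k x y, nthEdge ω k = s(x, y) →
      edgeSwap (nthEdge ω k) x = y ∧ edgeSwap (nthEdge ω k) y = x ∧
        x ∈ nthEdge ω k ∧ y ∈ nthEdge ω k := by
    intro k x y h
    rw [h]
    simp
  simp only [step_apply]
  cases h with
  | through k z d hz =>
    cases d
    · right; simp [stepDown, hz, edgeSwap_of_notMem hz]
    · left; simp [stepUp, hz, edgeSwap_of_notMem hz]
  | cross k x y d he hk =>
    obtain ⟨h1, h2, -⟩ := hsw k x y he
    cases d
    · right; simp [stepDown, hk, h2]
    · left; simp [stepUp, hk, h1]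
  | barBelow k x y d he hk =>
    obtain ⟨h1, h2, h3, h4⟩ := hsw k x y he
    cases d
    · right; simp [stepUp, hk, h2, h4]
    · left; simp [stepUp, hk, h1, h3]
  | barAbove k x y d he hk =>
    obtain ⟨h1, h2, h3, h4⟩ := hsw k x y he
    cases d
    · left; simp [stepDown, hk, h1, h3]
    · right; simp [stepDown, hk, h2, h4]
  | periodic x d =>
    cases d
    · right; simp
    · left; simp

variable [Finite Λ]

theorem sameDirLoop_iff {a b : DirPiece ω} : SameDirLoop ω a b ↔ (step ω).SameCycle a b := by
  constructor
  · intro h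
    induction h with
    | rel a b h =>
      rcases step_eq_of_link ω h with h | h
      · exact ⟨1, by simpa using h⟩
      · exact Equiv.Perm.SameCycle.symm ⟨1, by simpa using h⟩
    | refl => rfl
    | symm _ _ _ ih => exact ih.symm
    | trans _ _ _ _ _ i j => exact i.trans j
  · intro h
    have key : ∀ (n : ℕ) (a : DirPiece ω), SameDirLoop ω a ((step ω ^ n) a) := by
      intro n
      induction n with
      | zero => exact fun a => .refl _
      | succ n ih =>
        intro a
        rw [pow_succ, Equiv.Perm.mul_apply]
        refine .trans _ _ _ ?_ (ih _)
        rcases link_step ω a with h | h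
        · exact .rel _ _ h
        · exact .symm _ _ (.rel _ _ h)
    obtain ⟨n, -, rfl⟩ := h.exists_pow_eq'
    exact key n a

theorem not_sameCycle_flip (a : DirPiece ω) : ¬ (step ω).SameCycle a (flip a) :=
  not_sameCycle_reverse (step_flip_step ω) (by simp [flip, Prod.ext_iff])
    (step_ne_flip ω) a

theorem exists_loop_orientation : ∃ o : Piece ω → Bool, ∀ a b : DirPiece ω,
    (step ω).SameCycle a b → xor (o a.1) a.2 = xor (o b.1) b.2 :=
  exists_orientation (step ω) (step_flip_step ω) (not_sameCycle_flip ω)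

end Step

/-! ### Products of transition operators -/

section PathSum

variable {X : Type*} [Fintype X] [DecidableEq X]

theorem prod_ofFn_apply (n : ℕ) (M : Fin n → Matrix X X ℂ) (σ τ : X) :
    (List.ofFn M).prod σ τ = ∑ f : Fin (n + 1) → X,
      if f 0 = σ ∧ f (Fin.last n) = τ then ∏ k, M k (f k.castSucc) (f k.succ) else 0 := by
  induction n generalizing σ with
  | zero =>
    rw [← (Equiv.funUnique (Fin 1) X).symm.sum_comp]
    simp only [List.ofFn_zero, List.prod_nil, Finset.univ_eq_empty, Finset.prod_empty]
    rw [Matrix.one_apply]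
    simp [ite_and]
  | succ n ih =>
    rw [List.ofFn_succ, List.prod_cons, Matrix.mul_apply,
      ← (Fin.consEquiv fun _ => X).sum_comp, Fintype.sum_prod_type]
    symm
    rw [Finset.sum_eq_single σ]
    · symm
      simp only [ih, Finset.mul_sum]
      rw [Finset.sum_comm]
      refine Finset.sum_congr rfl fun g _ => ?_
      rw [Finset.sum_eq_single (g 0)]
      · simp [Fin.consEquiv, Fin.prod_univ_succ, ← Fin.succ_last]
      · intro b _ hb
        simp [hb.symm]
      · simp
    · intro b _ hb
      simp [Fin.consEquiv, hb]
    · simp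

/-- The trace closes the path through `O`, whose matrix element sits between the last slice and
slice `0`. -/
theorem trace_mul_prod_ofFn (n : ℕ) (O : Matrix X X ℂ) (M : Fin n → Matrix X X ℂ) :
    (O * (List.ofFn M).prod).trace = ∑ f : Fin (n + 1) → X,
      O (f (Fin.last n)) (f 0) * ∏ k, M k (f k.castSucc) (f k.succ) := by
  simp only [Matrix.trace, Matrix.diag, Matrix.mul_apply, prod_ofFn_apply, Finset.mul_sum]
  have : ∀ τ : X, ∑ σ : X, ∑ f : Fin (n + 1) → X, O τ σ *
      (if f 0 = σ ∧ f (Fin.last n) = τ then ∏ k, M k (f k.castSucc) (f k.succ) else 0) =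
      ∑ f : Fin (n + 1) → X, if f (Fin.last n) = τ then
        O τ (f 0) * ∏ k, M k (f k.castSucc) (f k.succ) else 0 := by
    intro τ
    rw [Finset.sum_comm]
    refine Finset.sum_congr rfl fun f _ => ?_
    simp [ite_and]
  simp only [this]
  rw [Finset.sum_comm]
  simp

end PathSum

/-- The sign `(-1)^a`. -/
def Spin.sgn {S : ℕ} (a : Spin S) : ℂ := (-1) ^ a.1

@[simp] theorem Spin.sgn_mul_self {S : ℕ} (a : Spin S) : a.sgn * a.sgn = 1 := by
  rw [Spin.sgn, ← mul_zpow]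
  norm_num

@[simp] theorem Spin.sgn_opp {S : ℕ} (a : Spin S) : a.opp.sgn = a.sgn := by
  simp only [Spin.sgn, Spin.opp, zpow_neg, ← inv_zpow]
  norm_num

theorem Spin.sgn_mul_sgn {S : ℕ} (a b : Spin S) : a.sgn * b.sgn = (-1) ^ (a.1 + b.1) := by
  rw [Spin.sgn, Spin.sgn, zpow_add₀ (by norm_num)]

theorem Spin.sgn_mul_sgn' {S : ℕ} (a b : Spin S) : a.sgn * b.sgn = (-1) ^ (a.1 - b.1) := by
  rw [← b.sgn_opp, Spin.sgn_mul_sgn]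
  rfl

/-- The sign of a spin that is met upwards. -/
def upSign {S : ℕ} (o : Bool) (a : Spin S) : ℂ := if o then a.sgn else 1

@[simp] theorem upSign_mul_self {S : ℕ} (o : Bool) (a : Spin S) :
    upSign o a * upSign o a = 1 := by
  cases o <;> simp [upSign]

/-! ### Matrix elements of the transitions, and their signs on oriented loops. -/

section Transition

variable {Λ : Type*} [Fintype Λ] [DecidableEq Λ] {S : ℕ}

theorem transOp_apply (e : Sym2 Λ) (σ τ : Λ → Spin S) :
    transOp S e σ τ = if ∀ z, σ z = τ (edgeSwap e z) then 1 else 0 := by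
  induction e with
  | _ x y =>
    simp only [transOp, Sym2.lift_mk, onPair, Matrix.of_apply, transElem, edgeSwap_mk, ← ite_and]
    congr 1
    apply propext
    constructor
    · rintro ⟨h, hx, hy⟩ z
      by_cases hzx : z = x
      · subst hzx; simpa using hx
      by_cases hzy : z = y
      · subst hzy; simpa using hy
      rw [Equiv.swap_apply_of_ne_of_ne hzx hzy]
      exact h z hzx hzy
    · intro h
      refine ⟨fun z hzx hzy => ?_, by simpa using h x, by simpa using h y⟩
      simpa [Equiv.swap_apply_of_ne_of_ne hzx hzy] using h z

/-- The sign can be read at either end of the edge, as `Spin.sgn` is invariant under `Spin.opp`. -/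
theorem singletOp_apply (e : Sym2 Λ) (σ τ : Λ → Spin S) {x : Λ} (hx : x ∈ e) :
    singletOp S e σ τ = if (∀ z, z ∉ e → σ z = τ z) ∧
      (∀ z, z ∈ e → σ z = (σ (edgeSwap e z)).opp ∧ τ z = (τ (edgeSwap e z)).opp) then
        (σ x).sgn * (τ x).sgn else 0 := by
  obtain ⟨y, rfl⟩ := hx
  simp only [singletOp, Sym2.lift_mk, onPair, Matrix.of_apply, singletElem, edgeSwap_mk, ← ite_and,
    Spin.sgn_mul_sgn']
  congr 1
  apply propext
  simp only [Sym2.mem_iff, not_or, forall_eq_or_imp, Equiv.swap_apply_left, forall_eq,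
    Equiv.swap_apply_right, and_imp]
  have key : ∀ {a b : Spin S}, a = b.opp → b = a.opp := by rintro a b rfl; simp
  constructor
  · rintro ⟨h, h1, h2⟩
    exact ⟨h, ⟨h1, h2⟩, key h1, key h2⟩
  · rintro ⟨h, ⟨h1, h2⟩, -⟩
    exact ⟨h, h1, h2⟩

variable {G : SimpleGraph Λ}

/-- The operator of a transition. -/
def transitionOp (S : ℕ) (e : Sym2 Λ) : Kind → ManyOp Λ S
  | Kind.cross => transOp S e
  | Kind.doubleBar => singletOp S e

variable (ω : Realization G)

/-- A configuration is consistent at the transition `k`. -/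
def ConsistentAt (f : Piece ω → Spin S) (k : Fin ω.1) : Prop :=
  ∀ z, Spin.dir (stepUp ω k z).2 (f (stepUp ω k z).1) = f (z, k.castSucc) ∧
    Spin.dir (stepDown ω k z).2 (f (stepDown ω k z).1) = (f (z, k.succ)).opp

theorem prod_edge {e : Sym2 Λ} (he : ¬ e.IsDiag) {x : Λ} (hx : x ∈ e) (g : Λ → ℂ)
    (hg : ∀ z, z ∉ e → g z = 1) : ∏ z, g z = g x * g (edgeSwap e x) := by
  refine Finset.prod_eq_mul x (edgeSwap e x) (edgeSwap_ne he hx).symm ?_ (by simp) (by simp)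
  intro z _ hz
  apply hg
  rw [mk_edgeSwap hx, Sym2.mem_iff]
  tauto

-- At a cross or an idle site the pieces below and above that are linked have equal orientation and
-- spin, so their signs square to one. At a double bar the two pieces on one side have opposite
-- orientations, so exactly one of them contributes its sign; together the two sides give the sign
-- of the singlet operator.
open scoped Classical in
theorem transitionOp_apply (f : Piece ω → Spin S) (o : Piece ω → Bool)
    (ho : ∀ a b : DirPiece ω, (step ω).SameCycle a b → xor (o a.1) a.2 = xor (o b.1) b.2)
    (k : Fin ω.1) :
    transitionOp S (nthEdge ω k) (nthKind ω k) (fun z => f (z, k.castSucc))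
        (fun z => f (z, k.succ)) =
      if ConsistentAt ω f k then
        ∏ z, (upSign (o (z, k.castSucc)) (f (z, k.castSucc)) *
          upSign (o (z, k.succ)) (f (z, k.succ))) else 0 := by
  have hou : ∀ z, xor (o (stepUp ω k z).1) (stepUp ω k z).2 = !o (z, k.castSucc) := by
    intro z
    have h := ho ((z, k.castSucc), true) (stepUp ω k z) ⟨1, by simp [step_apply]⟩
    simpa using h.symm
  have hod : ∀ z, xor (o (stepDown ω k z).1) (stepDown ω k z).2 = o (z, k.succ) := by
    intro z
    have h := ho ((z, k.succ), false) (stepDown ω k z) ⟨1, by simp [step_apply]⟩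
    simpa using h.symm
  have hdiag := nthEdge_not_isDiag ω k
  have hswap : ∀ z, z ∉ nthEdge ω k → edgeSwap (nthEdge ω k) z = z :=
    fun z h => edgeSwap_of_notMem h
  obtain ⟨x, hx⟩ : ∃ x, x ∈ nthEdge ω k := ⟨_, Sym2.out_fst_mem _⟩
  simp only [ConsistentAt]
  cases hk : nthKind ω k with
  | cross =>
    have hup : ∀ z, stepUp ω k z = ((edgeSwap (nthEdge ω k) z, k.succ), true) := by
      intro z; simp [stepUp, hk]
    have hdown : ∀ z, stepDown ω k z = ((edgeSwap (nthEdge ω k) z, k.castSucc), false) := by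
      intro z; simp [stepDown, hk]
    simp only [hup, hdown] at hou ⊢
    simp only [transitionOp, transOp_apply, Spin.dir_true, Spin.dir_false, Spin.opp_inj]
    have hiff : (∀ z, f (z, k.castSucc) = f (edgeSwap (nthEdge ω k) z, k.succ)) ↔
        ∀ z, f (edgeSwap (nthEdge ω k) z, k.succ) = f (z, k.castSucc) ∧
          f (edgeSwap (nthEdge ω k) z, k.castSucc) = f (z, k.succ) := by
      constructor
      · intro h z
        refine ⟨(h z).symm, ?_⟩
        rw [h, edgeSwap_edgeSwap]
      · exact fun h z => (h z).1.symm
    simp only [← hiff]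
    split_ifs with h
    · rw [Finset.prod_mul_distrib,
        ← Equiv.prod_comp (edgeSwap (nthEdge ω k)) fun z => upSign (o (z, k.succ)) (f (z, k.succ)),
        ← Finset.prod_mul_distrib]
      symm
      apply Finset.prod_eq_one
      intro z _
      have := hou z
      simp only [Bool.xor_true, Bool.not_eq_eq_eq_not, Bool.not_not] at this
      rw [this, ← h z, upSign_mul_self]
    · rfl
  | doubleBar =>
    have hup : ∀ z, z ∈ nthEdge ω k →
        stepUp ω k z = ((edgeSwap (nthEdge ω k) z, k.castSucc), false) := by
      intro z hz; simp [stepUp, hk, hz]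
    have hdown : ∀ z, z ∈ nthEdge ω k →
        stepDown ω k z = ((edgeSwap (nthEdge ω k) z, k.succ), true) := by
      intro z hz; simp [stepDown, hk, hz]
    have hup' : ∀ z, z ∉ nthEdge ω k → stepUp ω k z = ((z, k.succ), true) := by
      intro z hz; simp [stepUp, hz, hswap z hz]
    have hdown' : ∀ z, z ∉ nthEdge ω k → stepDown ω k z = ((z, k.castSucc), false) := by
      intro z hz; simp [stepDown, hz, hswap z hz]
    simp only [transitionOp]
    rw [singletOp_apply _ _ _ hx]
    have hiff : ((∀ z, z ∉ nthEdge ω k → f (z, k.castSucc) = f (z, k.succ)) ∧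
        ∀ z, z ∈ nthEdge ω k →
          f (z, k.castSucc) = (f (edgeSwap (nthEdge ω k) z, k.castSucc)).opp ∧
          f (z, k.succ) = (f (edgeSwap (nthEdge ω k) z, k.succ)).opp) ↔
        ∀ z, Spin.dir (stepUp ω k z).2 (f (stepUp ω k z).1) = f (z, k.castSucc) ∧
          Spin.dir (stepDown ω k z).2 (f (stepDown ω k z).1) = (f (z, k.succ)).opp := by
      constructor
      · rintro ⟨h1, h2⟩ z
        by_cases hz : z ∈ nthEdge ω k
        · rw [hup z hz, hdown z hz]
          simp [(h2 z hz).1, (h2 z hz).2]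
        · rw [hup' z hz, hdown' z hz]
          simp [h1 z hz]
      · intro h
        refine ⟨fun z hz => ?_, fun z hz => ?_⟩
        · have := h z
          rw [hup' z hz] at this
          simpa using this.1.symm
        · have := h z
          rw [hup z hz, hdown z hz] at this
          refine ⟨by simpa using this.1.symm, ?_⟩
          have h2 : f (edgeSwap (nthEdge ω k) z, k.succ) = (f (z, k.succ)).opp := by
            simpa using this.2
          rw [h2, Spin.opp_opp]
    simp only [← hiff]
    split_ifs with h
    · obtain ⟨h1, h2⟩ := h
      rw [prod_edge hdiag hx]
      · have e1 := hou x
        have e2 := hod x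
        rw [hup x hx] at e1
        rw [hdown x hx] at e2
        have e3 : o (edgeSwap (nthEdge ω k) x, k.castSucc) = !o (x, k.castSucc) := by
          simpa using e1
        have e4 : o (edgeSwap (nthEdge ω k) x, k.succ) = !o (x, k.succ) := by
          rw [← e2]; simp
        rw [e3, e4, (h2 x hx).1, (h2 x hx).2]
        cases o (x, k.castSucc) <;> cases o (x, k.succ) <;> simp [upSign, mul_comm]
      · intro z hz
        have e1 := hou z
        rw [hup' z hz] at e1
        have e3 : o (z, k.succ) = o (z, k.castSucc) := by simpa using e1
        rw [e3, h1 z hz, upSign_mul_self]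
    · rfl

theorem prod_telescope (n : ℕ) (g : Fin (n + 1) → ℂ) (hg : ∀ k, g k * g k = 1) :
    ∏ k : Fin n, (g k.castSucc * g k.succ) = g 0 * g (Fin.last n) := by
  induction n with
  | zero => simpa using (hg 0).symm
  | succ n ih =>
    rw [Fin.prod_univ_castSucc]
    have h := ih (fun k => g k.castSucc) (fun k => hg _)
    simp only [Fin.succ_castSucc] at h ⊢
    rw [h, Fin.castSucc_zero, Fin.succ_last, mul_assoc, ← mul_assoc (g (Fin.castSucc (Fin.last n))),
      hg, one_mul]

theorem onSite_mul_onSite_apply {x y : Λ} (hxy : x ≠ y) (A B : SiteOp S) (σ τ : Λ → Spin S) :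
    (onSite x A * onSite y B) σ τ =
      if ∀ z, z ≠ x → z ≠ y → σ z = τ z then A (σ x) (τ x) * B (σ y) (τ y) else 0 := by
  rw [Matrix.mul_apply, Finset.sum_eq_single (Function.update σ x (τ x))]
  · simp only [onSite, Matrix.of_apply]
    rw [if_pos (fun z hz => by simp [hz])]
    simp only [Function.update_self, Function.update_of_ne hxy.symm]
    have : (∀ z, z ≠ y → Function.update σ x (τ x) z = τ z) ↔
        ∀ z, z ≠ x → z ≠ y → σ z = τ z := by
      refine forall_congr' fun z => ?_
      by_cases hz : z = x
      · subst hz; simp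
      · simp [hz]
    simp only [this, mul_ite, mul_zero]
  · intro ρ _ hρ
    simp only [onSite, Matrix.of_apply]
    by_cases h1 : ∀ z, z ≠ x → σ z = ρ z
    · rw [if_pos h1]
      by_cases h2 : ∀ z, z ≠ y → ρ z = τ z
      · exfalso
        apply hρ
        funext z
        by_cases hz : z = x
        · subst hz; simpa using h2 z hxy
        · simp [hz, h1 z hz]
      · rw [if_neg h2, mul_zero]
    · rw [if_neg h1, zero_mul]
  · simp

/-- The product of the transition operators of a realization, in the order of times. -/
def transitionProd (S : ℕ) : ManyOp Λ S :=
  (List.ofFn fun k => transitionOp S (nthEdge ω k) (nthKind ω k)).prod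

/-- The link structure that is cut at time `0` on `x` and `y`. -/
abbrev CutLink (x y : Λ) : DirPiece ω → DirPiece ω → Prop :=
  CutStep (step ω) flip ((x, 0), true) ((y, 0), true)

/-- Steps through a transition never enter a cut point nor leave its reversal. All that the cut
removes is periodicity in time at `x` and `y`. -/
theorem consistent_cutLink_iff (f : Piece ω → Spin S) (x y : Λ) :
    Consistent (CutLink ω x y) f ↔ (∀ k, ConsistentAt ω f k) ∧
      ∀ z, z ≠ x → z ≠ y → f (z, Fin.last _) = f (z, 0) := by
  constructor
  · refine fun h => ⟨fun k z => ⟨?_, ?_⟩, fun z hx hy => ?_⟩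
    · have := h ((z, k.castSucc), true) (stepUp ω k z) ⟨by simp [step_apply], ?_, by simp [flip_mk]⟩
      · simpa using this.symm
      · simp only [stepUp]
        split_ifs <;> simp [Fin.succ_ne_zero]
    · have := h ((z, k.succ), false) (stepDown ω k z)
        ⟨by simp [step_apply], ?_, by simp [flip_mk, Fin.succ_ne_zero]⟩
      · simpa using this.symm
      · simp only [stepDown]
        split_ifs <;> simp [Fin.succ_ne_zero]
    · simpa [step_apply] using
        h ((z, Fin.last _), true) _ ⟨rfl, by simp [step_apply, hx, hy], by simp [flip_mk]⟩
  · rintro ⟨h1, h2⟩ a b ⟨rfl, ⟨hp, hq⟩, hp', hq'⟩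
    rw [step_apply] at hp hq ⊢
    induction a using dirPiece_cases with
    | up k z => simpa using (h1 k z).1.symm
    | down k z => simpa using (h1 k z).2.symm
    | top z =>
      simp only [stepFun_last, ne_eq, Prod.mk.injEq, and_true] at hp hq
      simpa using h2 z hp hq
    | bottom z =>
      simp only [flip_mk, ne_eq, Prod.mk.injEq, and_true, Bool.not_true] at hp' hq'
      simpa using congrArg Spin.opp (h2 z hp' hq').symm

-- Inner time slices touch two transitions, so their signs telescope away. In the first and last
-- slices the signs cancel at every site other than `x` and `y`, by periodicity.
open scoped Classical in
theorem trace_mul_transitionProd {x y : Λ} (hxy : x ≠ y) (A B : SiteOp S) (o : Piece ω → Bool)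
    (ho : ∀ a b : DirPiece ω, (step ω).SameCycle a b → xor (o a.1) a.2 = xor (o b.1) b.2) :
    (onSite x A * onSite y B * transitionProd ω S).trace =
      ∑ f : Piece ω → Spin S, if Consistent (CutLink ω x y) f then
        upSign (o (x, 0)) (f (x, 0)) * upSign (o (x, 0)) (f (x, Fin.last _)) *
          (upSign (o (y, 0)) (f (y, 0)) * upSign (o (y, 0)) (f (y, Fin.last _))) *
        (A (f (x, Fin.last _)) (f (x, 0)) * B (f (y, Fin.last _)) (f (y, 0))) else 0 := by
  rw [transitionProd, trace_mul_prod_ofFn]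
  let e : (Piece ω → Spin S) ≃ (Fin (ω.1 + 1) → Λ → Spin S) :=
    ((Equiv.prodComm _ _).arrowCongr (Equiv.refl _)).trans (Equiv.curry _ _ _)
  have he : ∀ f k z, e f k z = f (z, k) := fun f k z => rfl
  rw [← e.sum_comp]
  refine Finset.sum_congr rfl fun f _ => ?_
  have hof : ∀ z, o (z, Fin.last _) = o (z, 0) := by
    intro z
    have := ho ((z, Fin.last _), true) ((z, 0), true) ⟨1, by simp [step_apply]⟩
    simpa using this
  have hM : ∀ k, transitionOp S (nthEdge ω k) (nthKind ω k) (e f k.castSucc) (e f k.succ) = _ :=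
    fun k => transitionOp_apply ω f o ho k
  rw [Finset.prod_congr rfl fun k _ => hM k, onSite_mul_onSite_apply hxy]
  simp only [he, consistent_cutLink_iff]
  by_cases h1 : ∀ k, ConsistentAt ω f k
  · by_cases h2 : ∀ z, z ≠ x → z ≠ y → f (z, Fin.last _) = f (z, 0)
    · rw [if_pos h2, if_pos ⟨h1, h2⟩, Finset.prod_congr rfl fun k _ => if_pos (h1 k)]
      simp only [Finset.prod_mul_distrib]
      rw [← Finset.prod_mul_distrib, prod_telescope _
        (fun k => ∏ z, upSign (o (z, k)) (f (z, k))), ← Finset.prod_mul_distrib, mul_comm]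
      · congr 1
        rw [Finset.prod_eq_mul x y hxy _ (by simp) (by simp), hof, hof]
        intro z _ hz
        rw [hof, h2 z hz.1 hz.2, upSign_mul_self]
      · intro k
        rw [← Finset.prod_mul_distrib]
        simp
    · rw [if_neg h2, if_neg (c := _ ∧ _) (fun h => h2 h.2), zero_mul]
  · rw [if_neg (c := _ ∧ _) (fun h => h1 h.1)]
    obtain ⟨k, hk⟩ := not_forall.1 h1
    rw [Finset.prod_eq_zero (Finset.mem_univ k) (if_neg hk), mul_zero]

end Transition

/-! ### The trace for a given realization -/

section Separate

variable {P : Type*} [Finite P] {s : Equiv.Perm (P × Bool)}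

/-- The set from `exists_closed_separating` is invariant under reversal, so it is a set of
undirected pieces, and its indicator descends to the quotient. -/
theorem linkQuot_ne (hs : ∀ a : P × Bool, s ((s a).1, !(s a).2) = (a.1, !a.2)) (p q : P × Bool)
    (hne : p ≠ q) (hp : ¬ s.SameCycle p (p.1, !p.2)) (hq : ¬ s.SameCycle p (q.1, !q.2)) :
    (Quot.mk _ p.1 : LinkQuot (CutStep s (fun a => (a.1, !a.2)) p q)) ≠ Quot.mk _ q.1 := by
  obtain ⟨C, hC, hcl, hpC, hqC⟩ := exists_closed_separating (s := s)
    (r := fun a : P × Bool => (a.1, !a.2)) (by simp) hs p q hne hp hq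
  have hd : ∀ t d d', (t, d) ∈ C ↔ (t, d') ∈ C := by
    intro t d d'
    have h := hC (t, true)
    simp only [Bool.not_true] at h
    cases d <;> cases d'
    · rfl
    · exact h
    · exact h.symm
    · rfl
  intro h
  let F : LinkQuot (CutStep s (fun a => (a.1, !a.2)) p q) → Prop :=
    Quot.lift (fun t => (t, true) ∈ C) (by
      rintro t u ⟨d, d', h⟩
      rw [hd t true d, hd u true d']
      exact propext (hcl _ _ h))
  have hF : F (Quot.mk _ p.1) := (hd p.1 true p.2).2 hpC
  rw [h] at hF
  exact hqC ((hd q.1 true q.2).1 hF)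

theorem cutStep_comm {D : Type*} (s : Equiv.Perm D) (r : D → D) (p q : D) :
    CutStep s r p q = CutStep s r q p := by
  funext a b
  simp only [CutStep]
  apply propext
  tauto

end Separate

variable {Λ : Type*} [Fintype Λ] [DecidableEq Λ] {S : ℕ} {G : SimpleGraph Λ} (ω : Realization G)

theorem step_symm_zero (z : Λ) :
    (step ω).symm ((z, 0), true) = ((z, Fin.last ω.1), true) := by
  rw [Equiv.symm_apply_eq]; simp [step_apply]

theorem step_symm_last (z : Λ) :
    (step ω).symm ((z, Fin.last ω.1), false) = ((z, 0), false) := by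
  rw [Equiv.symm_apply_eq]; simp [step_apply]

/-- The periodic link at `y` may be cut from either end. Starting from the last piece travelled
downwards puts both cut points on one directed cycle when the loop meets `x` and `y` in opposite
directions. -/
theorem cutLink_eq (x y : Λ) : CutLink ω x y =
    CutStep (step ω) flip ((x, 0), true) ((y, Fin.last _), false) := by
  funext a b
  simp only [CutStep]
  apply propext
  refine and_congr_right fun hb => ?_
  have h1 : b = ((y, 0), true) ↔ a = flip ((y, Fin.last ω.1), false) := by
    rw [flip_mk, hb]
    change _ ↔ a = ((y, Fin.last ω.1), true)
    rw [← step_symm_zero, Equiv.eq_symm_apply]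
  have h2 : b = ((y, Fin.last ω.1), false) ↔ a = flip ((y, 0), true) := by
    rw [flip_mk, hb]
    change _ ↔ a = ((y, 0), false)
    rw [← step_symm_last, Equiv.eq_symm_apply]
  simp only [ne_eq, h1, h2]
  tauto

theorem sameCycle_flip {a b : DirPiece ω} (h : (step ω).SameCycle a b) :
    (step ω).SameCycle (flip a) (flip b) := by
  have key : ∀ (n : ℕ) (a : DirPiece ω), (step ω).SameCycle (flip a) (flip ((step ω ^ n) a)) := by
    intro n
    induction n with
    | zero => exact fun a => .refl _ _
    | succ n ih =>
      intro a
      rw [pow_succ, Equiv.Perm.mul_apply]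
      refine .trans ?_ (ih _)
      exact Equiv.Perm.SameCycle.symm ⟨1, by simpa using step_flip_step ω a⟩
  obtain ⟨n, -, rfl⟩ := h.exists_pow_eq'
  exact key n a

theorem consistent_link_iff (f : Piece ω → Spin S) (x y : Λ) :
    Consistent (Link ω) f ↔ Consistent (CutLink ω x y) f ∧
      f (x, Fin.last _) = f (x, 0) ∧ f (y, Fin.last _) = f (y, 0) := by
  constructor
  · intro h
    have hs : ∀ a b, (step ω).SameCycle a b → Spin.dir a.2 (f a.1) = Spin.dir b.2 (f b.1) :=
      fun a b hab => h.eqvGen ((sameDirLoop_iff ω).2 hab)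
    refine ⟨fun a b hab => hs a b ⟨1, by simpa using hab.1.symm⟩, ?_, ?_⟩
    · simpa using hs ((x, Fin.last _), true) ((x, 0), true) ⟨1, by simp [step_apply]⟩
    · simpa using hs ((y, Fin.last _), true) ((y, 0), true) ⟨1, by simp [step_apply]⟩
  · rintro ⟨h, hx, hy⟩
    obtain ⟨h1, h2⟩ := (consistent_cutLink_iff ω f x y).1 h
    have h3 : ∀ z, f (z, Fin.last _) = f (z, 0) := by
      intro z
      by_cases hzx : z = x
      · rw [hzx, hx]
      by_cases hzy : z = y
      · rw [hzy, hy]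
      exact h2 z hzx hzy
    have key : ∀ a : DirPiece ω, Spin.dir a.2 (f a.1) =
        Spin.dir (step ω a).2 (f (step ω a).1) := by
      intro a
      rw [step_apply]
      induction a using dirPiece_cases with
      | up k z => simpa using (h1 k z).1.symm
      | down k z => simpa using (h1 k z).2.symm
      | top z => simpa using h3 z
      | bottom z => simpa using congrArg Spin.opp (h3 z).symm
    intro a b hab
    rcases step_eq_of_link ω hab with h | h
    · rw [← h]; exact key a
    · rw [← h]; exact (key b).symm

theorem orient_of_link {o : Piece ω → Bool}
    (ho : ∀ a b : DirPiece ω, (step ω).SameCycle a b → xor (o a.1) a.2 = xor (o b.1) b.2)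
    (a b : DirPiece ω) (h : Link ω a b) : xor (o a.1) a.2 = xor (o b.1) b.2 :=
  ho a b ((sameDirLoop_iff ω).1 (.rel _ _ h))

theorem orient_of_cutLink {o : Piece ω → Bool}
    (ho : ∀ a b : DirPiece ω, (step ω).SameCycle a b → xor (o a.1) a.2 = xor (o b.1) b.2)
    (x y : Λ) (a b : DirPiece ω) (h : CutLink ω x y a b) :
    xor (o a.1) a.2 = xor (o b.1) b.2 :=
  ho a b ⟨1, by simpa using h.1.symm⟩

theorem onSite_one (x : Λ) : onSite x (1 : SiteOp S) = 1 := by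
  ext σ τ
  simp only [onSite, Matrix.of_apply, Matrix.one_apply, ← ite_and]
  congr 1
  apply propext
  constructor
  · rintro ⟨h1, h2⟩
    funext z
    by_cases hz : z = x
    · rw [hz, h2]
    · exact h1 z hz
  · rintro rfl
    simp

/-- The trace of the product of the transition operators counts the loops. -/
theorem trace_one_mul_transitionProd {x y : Λ} (hxy : x ≠ y) :
    (onSite x 1 * onSite y 1 * transitionProd ω S).trace = (2 * (S : ℂ) + 1) ^ numLoops ω := by
  classical
  obtain ⟨o, ho⟩ := exists_loop_orientation ω
  rw [trace_mul_transitionProd ω hxy 1 1 o ho]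
  -- With identities at `x` and `y` the cut loops are glued back and all signs are squares, so each
  -- uncut loop has one free spin.
  refine Eq.trans ?_ (sum_consistent_one (Link ω) o (orient_of_link ω ho))
  refine Finset.sum_congr rfl fun f _ => ?_
  rw [consistent_link_iff ω f x y, Matrix.one_apply, Matrix.one_apply]
  by_cases h : Consistent (CutLink ω x y) f
  · by_cases hx : f (x, Fin.last _) = f (x, 0)
    · by_cases hy : f (y, Fin.last _) = f (y, 0)
      · simp [h, hx, hy]
      · simp [h, hx, hy]
    · simp [h, hx]
  · simp [h]

theorem two_mul_add_one_ne_zero (S : ℕ) : (2 * (S : ℂ) + 1) ≠ 0 := by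
  exact_mod_cast Nat.succ_ne_zero (2 * S)

theorem card_spin_cast (S : ℕ) : (Fintype.card (Spin S) : ℂ) = 2 * S + 1 := by
  rw [card_spin]; push_cast; ring

theorem sum_one_opp (S : ℕ) : (∑ a : Spin S, ∑ b : Spin S, (-1 : ℂ) ^ (a.1 + b.1) *
    (1 : SiteOp S) a b * (1 : SiteOp S) a.opp b.opp) = 2 * S + 1 := by
  rw [← card_spin_cast]
  simp [Matrix.one_apply, Spin.opp_inj, ← Spin.sgn_mul_sgn]

/-! ### The three connectivity cases. -/

section Cases

variable {x y : Λ}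

theorem not_mem_eventMinus_of_mem_eventPlus (h : ω ∈ eventPlus G x y) : ω ∉ eventMinus G x y := by
  intro h'
  have h1 := (sameDirLoop_iff ω).1 h
  have h2 := (sameDirLoop_iff ω).1 h'
  exact not_sameCycle_flip ω ((y, 0), true) (h1.symm.trans h2)

/-- The arc going up from `(x,0)` ends at the top piece of `y`, and conversely. So the row spin of
each operator is the column spin of the other, and the remaining signs cancel. -/
theorem trace_of_mem_eventPlus (hxy : x ≠ y) (h : ω ∈ eventPlus G x y) (A B : SiteOp S) :
    (2 * (S : ℂ) + 1) * (onSite x A * onSite y B * transitionProd ω S).trace =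
      (2 * (S : ℂ) + 1) ^ numLoops ω * (A * B).trace := by
  classical
  obtain ⟨o, ho⟩ := exists_loop_orientation ω
  have hpq := (sameDirLoop_iff ω).1 h
  have hp := not_sameCycle_flip ω ((x, 0), true)
  have hq : ¬ (step ω).SameCycle ((x, 0), true) (flip ((y, 0), true)) :=
    fun h' => not_mem_eventMinus_of_mem_eventPlus ω h ((sameDirLoop_iff ω).2 h')
  have hp' : ¬ (step ω).SameCycle ((y, 0), true) (flip ((x, 0), true)) :=
    fun h' => hq (by simpa using (sameCycle_flip ω h').symm)
  have hne : (((x, 0), true) : DirPiece ω) ≠ ((y, 0), true) := by simp [hxy]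
  have c1 := cut_connected_of_sameCycle _ _ hne hp hq hpq
  have c2 := cut_connected_of_sameCycle _ _ hne.symm (not_sameCycle_flip ω ((y, 0), true))
    hp' hpq.symm
  rw [step_symm_zero] at c1 c2
  rw [cutStep_comm] at c2
  have hQ : (Quot.mk _ (x, 0) : LinkQuot (CutLink ω x y)) ≠ Quot.mk _ (y, 0) :=
    linkQuot_ne (step_flip_step ω) _ _ hne hp hq
  have hoxy : o (x, 0) = o (y, 0) := by simpa using ho _ _ hpq
  have key : ∀ A B : SiteOp S,
      (2 * (S : ℂ) + 1) ^ 2 * (onSite x A * onSite y B * transitionProd ω S).trace =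
        (2 * (S : ℂ) + 1) ^ Nat.card (LinkQuot (CutLink ω x y)) * (A * B).trace := by
    intro A B
    have htr : (A * B).trace = ∑ a, ∑ b, A b a * B a b := by
      rw [Finset.sum_comm]
      rfl
    rw [trace_mul_transitionProd ω hxy A B o ho, htr]
    refine sum_consistent_two (CutLink ω x y) o (orient_of_cutLink ω ho x y) (x, 0) (y, 0) hQ _
      (fun a b => A b a * B a b) fun f hf => ?_
    have e1 := hf.eqvGen c1
    have e2 := hf.eqvGen c2
    simp only [Spin.dir_true] at e1 e2
    rw [← e1, ← e2, hoxy]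
    have e3 := upSign_mul_self (o (y, 0)) (f (x, 0))
    have e4 := upSign_mul_self (o (y, 0)) (f (y, 0))
    linear_combination (A (f (y, 0)) (f (x, 0)) * B (f (x, 0)) (f (y, 0))) *
      (upSign (o (y, 0)) (f (y, 0)) * upSign (o (y, 0)) (f (y, 0)) * e3 + e4)
  -- The case `A = B = 1` compares the arc count with the loop count. Only powers of `2S+1` are
  -- compared, as the exponents are not determined when `S = 0`.
  have h1 := key 1 1
  rw [trace_one_mul_transitionProd ω hxy, mul_one, Matrix.trace_one, card_spin_cast] at h1
  have h2 := key A B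
  have hN := two_mul_add_one_ne_zero S
  have h3 : (2 * (S : ℂ) + 1) ^ Nat.card (LinkQuot (CutLink ω x y)) =
      (2 * (S : ℂ) + 1) * (2 * (S : ℂ) + 1) ^ numLoops ω := by
    apply mul_right_cancel₀ hN
    rw [← h1]; ring
  rw [h3] at h2
  apply mul_left_cancel₀ hN
  linear_combination h2

/-- One arc joins the bottom pieces of `x` and `y`, the other their top pieces, with flipped spins.
Exactly one of the two sites is oriented upwards at time `0`, and its two signs form `(-1)^(a+b)`.
-/
theorem trace_of_mem_eventMinus (hxy : x ≠ y) (h : ω ∈ eventMinus G x y) (A B : SiteOp S) :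
    (2 * (S : ℂ) + 1) * (onSite x A * onSite y B * transitionProd ω S).trace =
      (2 * (S : ℂ) + 1) ^ numLoops ω * ∑ a : Spin S, ∑ b : Spin S,
        (-1 : ℂ) ^ (a.1 + b.1) * A a b * B a.opp b.opp := by
  classical
  obtain ⟨o, ho⟩ := exists_loop_orientation ω
  have hpq0 := (sameDirLoop_iff ω).1 h
  have hst : (step ω).SameCycle ((y, 0), false) ((y, Fin.last _), false) :=
    ⟨1, by simp [step_apply]⟩
  have hpq := hpq0.trans hst
  have hp := not_sameCycle_flip ω ((x, 0), true)
  have hq : ¬ (step ω).SameCycle ((x, 0), true) (flip ((y, Fin.last _), false)) :=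
    fun h' => not_sameCycle_flip ω _ (hpq.symm.trans h')
  have hp' : ¬ (step ω).SameCycle ((y, Fin.last _), false) (flip ((x, 0), true)) :=
    fun h' => hq (by simpa using (sameCycle_flip ω h').symm)
  have hne : (((x, 0), true) : DirPiece ω) ≠ ((y, Fin.last _), false) := by simp
  have c1 := cut_connected_of_sameCycle _ _ hne hp hq hpq
  have c2 := cut_connected_of_sameCycle _ _ hne.symm (not_sameCycle_flip ω _) hp' hpq.symm
  rw [step_symm_last, ← cutLink_eq] at c1
  rw [step_symm_zero, cutStep_comm, ← cutLink_eq] at c2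
  have hQ : (Quot.mk _ (x, 0) : LinkQuot
      (CutStep (step ω) flip ((x, 0), true) ((y, Fin.last _), false))) ≠
        Quot.mk _ (y, Fin.last _) := linkQuot_ne (step_flip_step ω) _ _ hne hp hq
  -- The second arc is represented by its end at the top of `x`, so that the two free spins are the
  -- indices of `A`.
  have hQ' : (Quot.mk _ (x, 0) : LinkQuot (CutLink ω x y)) ≠ Quot.mk _ (x, Fin.last _) := by
    have hsame : (Quot.mk _ (x, Fin.last _) : LinkQuot (CutLink ω x y)) =
        Quot.mk _ (y, Fin.last _) := by
      have : ∀ a b : DirPiece ω, Relation.EqvGen (CutLink ω x y) a b →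
          (Quot.mk _ a.1 : LinkQuot (CutLink ω x y)) = Quot.mk _ b.1 := by
        intro a b hab
        induction hab with
        | rel a b h => exact Quot.sound ⟨a.2, b.2, h⟩
        | refl => rfl
        | symm _ _ _ ih => exact ih.symm
        | trans _ _ _ _ _ i j => exact i.trans j
      exact (this _ _ c2).symm
    rw [hsame]
    have := cutLink_eq ω x y
    intro h'
    apply hQ
    rw [← this]
    exact h'
  have hoxy : o (y, 0) = !o (x, 0) := by simpa using (ho _ _ hpq0).symm
  have key : ∀ A B : SiteOp S,
      (2 * (S : ℂ) + 1) ^ 2 * (onSite x A * onSite y B * transitionProd ω S).trace =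
        (2 * (S : ℂ) + 1) ^ Nat.card (LinkQuot (CutLink ω x y)) * ∑ a : Spin S, ∑ b : Spin S,
        (-1 : ℂ) ^ (a.1 + b.1) * A a b * B a.opp b.opp := by
    intro A B
    rw [trace_mul_transitionProd ω hxy A B o ho, Finset.sum_comm]
    refine sum_consistent_two (CutLink ω x y) o (orient_of_cutLink ω ho x y) (x, 0)
      (x, Fin.last _) hQ' _ (fun b a => (-1 : ℂ) ^ (a.1 + b.1) * A a b * B a.opp b.opp)
      fun f hf => ?_
    have e1 := hf.eqvGen c1
    have e2 := hf.eqvGen c2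
    simp only [Spin.dir_true, Spin.dir_false] at e1 e2
    have e1' : f (y, 0) = (f (x, 0)).opp := by rw [e1, Spin.opp_opp]
    have e2' : f (y, Fin.last _) = (f (x, Fin.last _)).opp := by rw [← e2, Spin.opp_opp]
    rw [e1', e2', hoxy, ← Spin.sgn_mul_sgn]
    cases o (x, 0) <;> simp [upSign] <;> ring
  have h1 := key 1 1
  rw [trace_one_mul_transitionProd ω hxy, sum_one_opp] at h1
  have h2 := key A B
  have hN := two_mul_add_one_ne_zero S
  have h3 : (2 * (S : ℂ) + 1) ^ Nat.card (LinkQuot (CutLink ω x y)) =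
      (2 * (S : ℂ) + 1) * (2 * (S : ℂ) + 1) ^ numLoops ω := by
    apply mul_right_cancel₀ hN
    rw [← h1]; ring
  rw [h3] at h2
  apply mul_left_cancel₀ hN
  linear_combination h2

/-- Each cut loop is a single arc from bottom to top of its own site, so only diagonal entries occur
and cutting leaves the number of classes as it was. -/
theorem trace_of_notMem_eventSame (hxy : x ≠ y) (h : ω ∉ eventSame G x y) (A B : SiteOp S) :
    (2 * (S : ℂ) + 1) ^ 2 * (onSite x A * onSite y B * transitionProd ω S).trace =
      (2 * (S : ℂ) + 1) ^ numLoops ω * (A.trace * B.trace) := by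
  classical
  obtain ⟨o, ho⟩ := exists_loop_orientation ω
  have hpq : ¬ (step ω).SameCycle ((x, 0), true) ((y, 0), true) :=
    fun h' => h (Or.inl ((sameDirLoop_iff ω).2 h'))
  have hq : ¬ (step ω).SameCycle ((x, 0), true) (flip ((y, 0), true)) :=
    fun h' => h (Or.inr ((sameDirLoop_iff ω).2 h'))
  have hp := not_sameCycle_flip ω ((x, 0), true)
  have hp' : ¬ (step ω).SameCycle ((y, 0), true) (flip ((x, 0), true)) :=
    fun h' => hq (by simpa using (sameCycle_flip ω h').symm)
  have hne : (((x, 0), true) : DirPiece ω) ≠ ((y, 0), true) := by simp [hxy]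
  have c1 := cut_connected_of_not_sameCycle _ _ hp hq hpq
  have c2 := cut_connected_of_not_sameCycle _ _ (not_sameCycle_flip ω ((y, 0), true)) hp'
    (fun h' => hpq h'.symm)
  rw [step_symm_zero] at c1 c2
  rw [cutStep_comm] at c2
  have hQ : (Quot.mk _ (x, 0) : LinkQuot (CutLink ω x y)) ≠ Quot.mk _ (y, 0) :=
    linkQuot_ne (step_flip_step ω) _ _ hne hp hq
  have key : ∀ A B : SiteOp S,
      (2 * (S : ℂ) + 1) ^ 2 * (onSite x A * onSite y B * transitionProd ω S).trace =
        (2 * (S : ℂ) + 1) ^ Nat.card (LinkQuot (CutLink ω x y)) * (A.trace * B.trace) := by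
    intro A B
    have htr : A.trace * B.trace = ∑ a, ∑ b, A a a * B b b := Finset.sum_mul_sum _ _ _ _
    rw [trace_mul_transitionProd ω hxy A B o ho, htr]
    refine sum_consistent_two (CutLink ω x y) o (orient_of_cutLink ω ho x y) (x, 0) (y, 0) hQ _
      (fun a b => A a a * B b b) fun f hf => ?_
    have e1 := hf.eqvGen c1
    have e2 := hf.eqvGen c2
    simp only [Spin.dir_true] at e1 e2
    rw [← e1, ← e2]
    simp
  have h1 := key 1 1
  rw [trace_one_mul_transitionProd ω hxy, Matrix.trace_one, card_spin_cast] at h1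
  have h2 := key A B
  have hN := two_mul_add_one_ne_zero S
  have h3 : (2 * (S : ℂ) + 1) ^ Nat.card (LinkQuot (CutLink ω x y)) =
      (2 * (S : ℂ) + 1) ^ numLoops ω := by
    apply mul_right_cancel₀ (pow_ne_zero 2 hN)
    linear_combination -h1
  rw [h2, h3]

/-- The weight `1_E (2S+1)^|𝓛|`. -/
abbrev loopWeight (S : ℕ) (E : Set (Realization G)) (ω : Realization G) : ℝ :=
  E.indicator (fun ω => ((2 * S + 1 : ℝ)) ^ numLoops ω) ω

theorem trace_eq_loopWeight (hxy : x ≠ y) (A B : SiteOp S) :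
    (onSite x A * onSite y B * transitionProd ω S).trace =
      1 / (2 * (S : ℂ) + 1) * (A * B).trace * loopWeight S (eventPlus G x y) ω +
      1 / (2 * (S : ℂ) + 1) * (∑ a : Spin S, ∑ b : Spin S,
        (-1 : ℂ) ^ (a.1 + b.1) * A a b * B a.opp b.opp) * loopWeight S (eventMinus G x y) ω +
      1 / (2 * (S : ℂ) + 1) ^ 2 * A.trace * B.trace * loopWeight S (eventSame G x y)ᶜ ω := by
  have hN := two_mul_add_one_ne_zero S
  by_cases hp : ω ∈ eventPlus G x y
  · have h1 := trace_of_mem_eventPlus ω hxy hp A B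
    have h2 := not_mem_eventMinus_of_mem_eventPlus ω hp
    have h3 : ω ∉ (eventSame G x y)ᶜ := fun h => h (Or.inl hp)
    simp only [loopWeight, Set.indicator_of_mem hp, Set.indicator_of_notMem h2,
      Set.indicator_of_notMem h3]
    push_cast
    rw [← mul_right_inj' hN, h1]
    field_simp
    ring
  · by_cases hm : ω ∈ eventMinus G x y
    · have h1 := trace_of_mem_eventMinus ω hxy hm A B
      have h3 : ω ∉ (eventSame G x y)ᶜ := fun h => h (Or.inr hm)
      simp only [loopWeight, Set.indicator_of_mem hm, Set.indicator_of_notMem hp,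
        Set.indicator_of_notMem h3]
      push_cast
      rw [← mul_right_inj' hN, h1]
      field_simp
      ring
    · have h3 : ω ∉ eventSame G x y := fun h => h.elim hp hm
      have h1 := trace_of_notMem_eventSame ω hxy h3 A B
      have h4 : ω ∈ (eventSame G x y)ᶜ := h3
      simp only [loopWeight, Set.indicator_of_mem h4, Set.indicator_of_notMem hp,
        Set.indicator_of_notMem hm]
      push_cast
      rw [← mul_right_inj' (pow_ne_zero 2 hN), h1]
      field_simp
      ring

end Cases

/-! ### Spin operators -/

section SpinOps

variable (S : ℕ)

theorem spin_sum_eq {M : Type*} [AddCommMonoid M] (F : ℤ → M) :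
    ∑ a : Spin S, F a.1 = ∑ a ∈ Finset.Icc (-(S : ℤ)) S, F a :=
  Finset.sum_coe_sort (Finset.Icc (-(S : ℤ)) S) F

/-- The right side counts `a = 0` twice, hence the condition `k ≠ 0`. -/
theorem sum_Icc_even_pow (k : ℕ) (hk : Even k) (hk0 : k ≠ 0) :
    ∑ a ∈ Finset.Icc (-(S : ℤ)) S, (a : ℂ) ^ k =
      2 * ∑ j ∈ Finset.range (S + 1), (j : ℂ) ^ k := by
  induction S with
  | zero => simp [hk0]
  | succ S ih =>
    have h : Finset.Icc (-((S + 1 : ℕ) : ℤ)) ((S + 1 : ℕ) : ℤ) =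
        insert (-((S : ℤ) + 1)) (insert ((S : ℤ) + 1) (Finset.Icc (-(S : ℤ)) S)) := by
      ext a
      simp only [Finset.mem_Icc, Finset.mem_insert]
      omega
    rw [h, Finset.sum_insert (by simp only [Finset.mem_Icc, Finset.mem_insert]; omega),
      Finset.sum_insert (by simp only [Finset.mem_Icc]; omega), ih,
      Finset.sum_range_succ _ (S + 1)]
    push_cast
    rw [hk.neg_pow]
    ring

theorem sum_spin_sq :
    ∑ a : Spin S, ((a.1 : ℤ) : ℂ) ^ 2 = (2 * S + 1) * (S * (S + 1) / 3) := by
  rw [spin_sum_eq S fun a => (a : ℂ) ^ 2, sum_Icc_even_pow S 2 even_two two_ne_zero]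
  have : ∀ n : ℕ, ∑ j ∈ Finset.range (n + 1), (j : ℂ) ^ 2 =
      (2 * n + 1) * (n * (n + 1) / 6) := by
    intro n
    induction n with
    | zero => simp
    | succ n ih =>
      rw [Finset.sum_range_succ, ih]
      push_cast
      ring
  rw [this]
  ring

theorem sum_spin_pow_four :
    ∑ a : Spin S, ((a.1 : ℤ) : ℂ) ^ 4 =
      (2 * S + 1) * (S * (S + 1) * (3 * S ^ 2 + 3 * S - 1) / 15) := by
  rw [spin_sum_eq S fun a => (a : ℂ) ^ 4, sum_Icc_even_pow S 4 (by decide) (by norm_num)]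
  have : ∀ n : ℕ, ∑ j ∈ Finset.range (n + 1), (j : ℂ) ^ 4 =
      (2 * n + 1) * (n * (n + 1) * (3 * n ^ 2 + 3 * n - 1) / 30) := by
    intro n
    induction n with
    | zero => simp
    | succ n ih =>
      rw [Finset.sum_range_succ, ih]
      push_cast
      ring
  rw [this]
  ring

theorem spinOp_two : spinOp S 2 = Matrix.diagonal fun a => ((a.1 : ℤ) : ℂ) := rfl

theorem spinOp_zero :
    spinOp S 0 = (1 / 2 : ℂ) • (raising S + (raising S)ᴴ) := rfl

theorem spinOp_one :
    spinOp S 1 = (1 / (2 * Complex.I) : ℂ) • (raising S - (raising S)ᴴ) := rfl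

theorem raising_conjTranspose_apply (a b : Spin S) : (raising S)ᴴ a b = raising S b a := by
  rw [Matrix.conjTranspose_apply, raising, Matrix.of_apply]
  split_ifs
  · exact Complex.conj_ofReal _
  · simp

theorem raising_opp (a b : Spin S) : raising S a.opp b.opp = raising S b a := by
  simp only [raising, Matrix.of_apply, Spin.opp]
  by_cases h : b.1 = a.1 + 1
  · rw [if_pos h, if_pos (by omega)]
    congr 2
    rw [h]
    push_cast
    ring
  · rw [if_neg h, if_neg (by omega)]

theorem raising_sign (a b : Spin S) : (-1 : ℂ) ^ (a.1 + b.1) * raising S a b = -raising S a b := by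
  simp only [raising, Matrix.of_apply]
  split_ifs with h
  · rw [h, show b.1 + 1 + b.1 = 2 * b.1 + 1 by ring, zpow_add₀ (by norm_num), zpow_mul]
    norm_num
  · simp

/-- Spin operators change sign under the spin flip followed by transposition. -/
theorem spinOp_opp (i : Fin 3) (a b : Spin S) :
    (-1 : ℂ) ^ (a.1 + b.1) * spinOp S i a.opp b.opp = - spinOp S i b a := by
  have h1 := raising_sign S a b
  have h2 := raising_sign S b a
  rw [add_comm b.1] at h2
  fin_cases i
  · change _ * spinOp S 0 _ _ = - spinOp S 0 _ _
    simp only [spinOp_zero, Matrix.smul_apply, Matrix.add_apply, raising_conjTranspose_apply,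
      raising_opp, smul_eq_mul]
    linear_combination (1 / 2 : ℂ) * h1 + (1 / 2 : ℂ) * h2
  · change _ * spinOp S 1 _ _ = - spinOp S 1 _ _
    simp only [spinOp_one, Matrix.smul_apply, Matrix.sub_apply, raising_conjTranspose_apply,
      raising_opp, smul_eq_mul]
    linear_combination (1 / (2 * Complex.I) : ℂ) * h2 - (1 / (2 * Complex.I) : ℂ) * h1
  · change _ * spinOp S 2 _ _ = - spinOp S 2 _ _
    simp only [spinOp_two, Matrix.diagonal_apply]
    by_cases h : a = b
    · subst h
      rw [if_pos rfl, if_pos rfl, ← two_mul, zpow_mul]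
      simp [Spin.opp]
    · have h' : a.opp ≠ b.opp := by
        intro h'
        apply h
        have := congrArg Subtype.val h'
        simp only [Spin.opp, neg_inj] at this
        exact Subtype.ext this
      rw [if_neg h', if_neg (Ne.symm h)]
      simp

theorem raising_eq_zero_of_ne {a b : Spin S} (h : a.1 ≠ b.1 + 1) : raising S a b = 0 := by
  simp [raising, h]

theorem raising_mul_raising (a b c : Spin S) :
    raising S a b * raising S c b = if a = c ∧ a.1 = b.1 + 1 then
      ((S : ℂ) * (S + 1) - (b.1 : ℂ) * (b.1 + 1)) else 0 := by
  by_cases h : a = c ∧ a.1 = b.1 + 1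
  · rw [if_pos h, ← h.1]
    simp only [raising, Matrix.of_apply, if_pos h.2]
    rw [← Complex.ofReal_mul, Real.mul_self_sqrt]
    · push_cast; ring
    · have h1 := Finset.mem_Icc.1 a.2
      have h2 := Finset.mem_Icc.1 b.2
      have h3 : (b.1 : ℝ) + 1 ≤ S := by exact_mod_cast h.2 ▸ h1.2
      have h4 : -(S : ℝ) ≤ b.1 := by exact_mod_cast h2.1
      nlinarith
  · rw [if_neg h]
    by_cases h1 : a.1 = b.1 + 1
    · by_cases h2 : c.1 = b.1 + 1
      · exact absurd ⟨Subtype.ext (h1.trans h2.symm), h1⟩ h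
      · rw [raising_eq_zero_of_ne S h2, mul_zero]
    · rw [raising_eq_zero_of_ne S h1, zero_mul]

theorem raising_mul_raising' (a b c : Spin S) :
    raising S b a * raising S b c = if a = c ∧ b.1 = a.1 + 1 then
      ((S : ℂ) * (S + 1) - (a.1 : ℂ) * (a.1 + 1)) else 0 := by
  by_cases h : a = c
  · subst h
    rw [raising_mul_raising]
    simp
  · rw [if_neg (fun h' => h h'.1)]
    by_cases h1 : b.1 = a.1 + 1
    · have : b.1 ≠ c.1 + 1 := fun h2 => h (Subtype.ext (by omega))
      rw [raising_eq_zero_of_ne S this, mul_zero]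
    · rw [raising_eq_zero_of_ne S h1, zero_mul]

/-- `[S⁺, S⁻] = 2 S³`. -/
theorem raising_commutator :
    raising S * (raising S)ᴴ - (raising S)ᴴ * raising S = 2 • spinOp S 2 := by
  ext a c
  simp only [Matrix.sub_apply, Matrix.mul_apply, raising_conjTranspose_apply,
    raising_mul_raising, raising_mul_raising', spinOp_two, Matrix.smul_apply,
    Matrix.diagonal_apply]
  by_cases h : a = c
  · subst h
    simp only [true_and, if_true]
    have ha := Finset.mem_Icc.1 a.2
    have e1 : ∑ b : Spin S, (if a.1 = b.1 + 1 then ((S : ℂ) * (S + 1) - (b.1 : ℂ) * (b.1 + 1))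
        else 0) = (S : ℂ) * (S + 1) - ((a.1 : ℂ) - 1) * a.1 := by
      by_cases hl : -(S : ℤ) ≤ a.1 - 1
      · rw [Finset.sum_eq_single ⟨a.1 - 1, Finset.mem_Icc.2 ⟨hl, by omega⟩⟩]
        · simp
        · intro b _ hb
          rw [if_neg]
          intro h
          exact hb (Subtype.ext (by simp only; omega))
        · simp
      -- At the lowest spin the sum is empty, and the closed formula vanishes there as well.
      · rw [Finset.sum_eq_zero]
        · have : a.1 = -(S : ℤ) := by omega
          rw [this]; push_cast; ring
        · intro b _
          have := Finset.mem_Icc.1 b.2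
          rw [if_neg (by omega)]
    have e2 : ∑ b : Spin S, (if b.1 = a.1 + 1 then ((S : ℂ) * (S + 1) - (a.1 : ℂ) * (a.1 + 1))
        else 0) = (S : ℂ) * (S + 1) - (a.1 : ℂ) * (a.1 + 1) := by
      by_cases hl : a.1 + 1 ≤ S
      · rw [Finset.sum_eq_single ⟨a.1 + 1, Finset.mem_Icc.2 ⟨by omega, hl⟩⟩]
        · simp
        · intro b _ hb
          rw [if_neg]
          intro h
          exact hb (Subtype.ext (by simp only; omega))
        · simp
      · rw [Finset.sum_eq_zero]
        · have : a.1 = (S : ℤ) := by omega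
          rw [this]; push_cast; ring
        · intro b _
          have := Finset.mem_Icc.1 b.2
          rw [if_neg (by omega)]
    rw [e1, e2, nsmul_eq_mul]
    push_cast
    ring
  · simp [h]

/-- `[S³, S⁺] = S⁺`. -/
theorem commutator_raising :
    spinOp S 2 * raising S - raising S * spinOp S 2 = raising S := by
  ext a b
  rw [spinOp_two, Matrix.sub_apply, Matrix.diagonal_mul, Matrix.mul_diagonal]
  by_cases h : a.1 = b.1 + 1
  · rw [h]; push_cast; ring
  · rw [raising_eq_zero_of_ne S h]; ring

/-- `[S³, S⁻] = -S⁻`. -/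
theorem commutator_lowering :
    spinOp S 2 * (raising S)ᴴ - (raising S)ᴴ * spinOp S 2 = -(raising S)ᴴ := by
  ext a b
  rw [spinOp_two, Matrix.sub_apply, Matrix.diagonal_mul, Matrix.mul_diagonal, Matrix.neg_apply,
    raising_conjTranspose_apply]
  by_cases h : b.1 = a.1 + 1
  · rw [h]; push_cast; ring
  · rw [raising_eq_zero_of_ne S h]; ring

theorem spinOp_commutator_zero_one :
    spinOp S 0 * spinOp S 1 - spinOp S 1 * spinOp S 0 = Complex.I • spinOp S 2 := by
  have h := raising_commutator S
  have hI : (2 * Complex.I : ℂ) ≠ 0 := by simp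
  have : spinOp S 0 * spinOp S 1 - spinOp S 1 * spinOp S 0 =
      (-(1 / (2 * Complex.I)) : ℂ) •
        (raising S * (raising S)ᴴ - (raising S)ᴴ * raising S) := by
    rw [spinOp_zero, spinOp_one]
    simp only [Matrix.smul_mul, Matrix.mul_smul, mul_sub, mul_add, sub_mul, add_mul]
    module
  rw [this, h, ← Nat.cast_smul_eq_nsmul ℂ, smul_smul]
  congr 1
  field_simp
  push_cast
  linear_combination -2 * Complex.I_sq

theorem spinOp_commutator_two_zero :
    spinOp S 2 * spinOp S 0 - spinOp S 0 * spinOp S 2 = Complex.I • spinOp S 1 := by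
  have : spinOp S 2 * spinOp S 0 - spinOp S 0 * spinOp S 2 =
      (1 / 2 : ℂ) • ((spinOp S 2 * raising S - raising S * spinOp S 2) +
        (spinOp S 2 * (raising S)ᴴ - (raising S)ᴴ * spinOp S 2)) := by
    rw [spinOp_zero]
    simp only [Matrix.smul_mul, Matrix.mul_smul, mul_add, add_mul]
    module
  rw [this, commutator_raising, commutator_lowering, spinOp_one, smul_smul, ← sub_eq_add_neg]
  congr 1
  have : Complex.I ≠ 0 := Complex.I_ne_zero
  field_simp

theorem spinOp_commutator_one_two :
    spinOp S 1 * spinOp S 2 - spinOp S 2 * spinOp S 1 = Complex.I • spinOp S 0 := by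
  have : spinOp S 1 * spinOp S 2 - spinOp S 2 * spinOp S 1 =
      (-(1 / (2 * Complex.I)) : ℂ) • ((spinOp S 2 * raising S - raising S * spinOp S 2) -
        (spinOp S 2 * (raising S)ᴴ - (raising S)ᴴ * spinOp S 2)) := by
    rw [spinOp_one]
    simp only [Matrix.smul_mul, Matrix.mul_smul, mul_sub, sub_mul]
    module
  rw [this, commutator_raising, commutator_lowering, spinOp_zero, smul_smul, sub_neg_eq_add]
  congr 1
  have : Complex.I ≠ 0 := Complex.I_ne_zero
  field_simp
  linear_combination -Complex.I_sq

/-! ### Equality of traces under an infinitesimal rotation. -/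

section Rotation

variable {n : Type*} [Fintype n]

theorem trace_commutator (A B : Matrix n n ℂ) : (A * B - B * A).trace = 0 := by
  rw [Matrix.trace_sub, Matrix.trace_mul_comm, sub_self]

variable [DecidableEq n]

/-- If `ad Y` rotates `X` into `Z`, the traces of the second and fourth powers agree. -/
theorem trace_sq_eq_of_rotation {X Y Z : Matrix n n ℂ} {c : ℂ} (hc : c ≠ 0)
    (h1 : Y * X - X * Y = c • Z) (h2 : Y * Z - Z * Y = -c • X) :
    (X ^ 2).trace = (Z ^ 2).trace := by
  -- The derivation `ad Y` sends `X Z` to a multiple of `Z² - X²`, and commutators are traceless.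
  have h : Y * (X * Z) - (X * Z) * Y = c • (Z * Z) - c • (X * X) := by
    have : Y * (X * Z) - (X * Z) * Y = (Y * X - X * Y) * Z + X * (Y * Z - Z * Y) := by
      noncomm_ring
    rw [this, h1, h2]
    simp only [Matrix.smul_mul, Matrix.mul_smul]
    module
  have h3 := trace_commutator Y (X * Z)
  rw [h, Matrix.trace_sub, Matrix.trace_smul, Matrix.trace_smul, ← smul_sub, smul_eq_zero] at h3
  rw [sq, sq]
  exact (sub_eq_zero.1 (h3.resolve_left hc)).symm

/-- The vanishing trace of `[Y, X³ Z]` expresses `tr X⁴` by mixed traces that are symmetric in `X`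
and `Z`. The same identity with `X`, `Z` exchanged and `c` negated gives `tr Z⁴`. -/
theorem trace_pow_four_eq_of_rotation {X Y Z : Matrix n n ℂ} {c : ℂ} (hc : c ≠ 0)
    (h1 : Y * X - X * Y = c • Z) (h2 : Y * Z - Z * Y = -c • X) :
    (X ^ 4).trace = (Z ^ 4).trace := by
  have aux : ∀ {X Z : Matrix n n ℂ} {c : ℂ}, c ≠ 0 → Y * X - X * Y = c • Z →
      Y * Z - Z * Y = -c • X →
      (X ^ 4).trace = 2 * (X ^ 2 * Z ^ 2).trace + (X * Z * X * Z).trace := by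
    intro X Z c hc h1 h2
    have h : Y * (X ^ 3 * Z) - (X ^ 3 * Z) * Y =
        c • (Z * X ^ 2 * Z + X * Z * X * Z + X ^ 2 * Z ^ 2 - X ^ 4) := by
      have : Y * (X ^ 3 * Z) - (X ^ 3 * Z) * Y = (Y * X - X * Y) * X ^ 2 * Z +
          X * (Y * X - X * Y) * X * Z + X ^ 2 * (Y * X - X * Y) * Z +
          X ^ 3 * (Y * Z - Z * Y) := by
        noncomm_ring
      rw [this, h1, h2]
      simp only [Matrix.smul_mul, Matrix.mul_smul, neg_smul, mul_neg, smul_add, smul_sub]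
      noncomm_ring
    have h3 := trace_commutator Y (X ^ 3 * Z)
    rw [h, Matrix.trace_smul, smul_eq_zero] at h3
    have h4 := h3.resolve_left hc
    rw [Matrix.trace_sub, Matrix.trace_add, Matrix.trace_add, mul_assoc Z,
      Matrix.trace_mul_comm Z, mul_assoc (X ^ 2), ← sq] at h4
    linear_combination -h4
  rw [aux hc h1 h2, aux (neg_ne_zero.2 hc) h2 (by simpa using h1), Matrix.trace_mul_comm (X ^ 2),
    mul_assoc X, mul_assoc X, Matrix.trace_mul_comm X]

end Rotation

theorem trace_spinOp_sq (i : Fin 3) :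
    (spinOp S i ^ 2).trace = (2 * S + 1) * (S * (S + 1) / 3) := by
  have h2 : (spinOp S 2 ^ 2).trace = (2 * S + 1) * (S * (S + 1) / 3) := by
    rw [spinOp_two, Matrix.diagonal_pow, Matrix.trace_diagonal, ← sum_spin_sq]
    rfl
  have a := spinOp_commutator_zero_one S
  have b := spinOp_commutator_one_two S
  have c := spinOp_commutator_two_zero S
  have hneg : ∀ {A B : SiteOp S} {C : SiteOp S}, A * B - B * A = Complex.I • C →
      B * A - A * B = -Complex.I • C := by
    intro A B C h
    rw [← neg_sub, h, neg_smul]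
  fin_cases i
  · refine Eq.trans ?_ h2
    refine trace_sq_eq_of_rotation (Y := spinOp S 1) (c := -Complex.I) (by simp) (hneg a) ?_
    simpa using b
  · refine Eq.trans ?_ h2
    exact trace_sq_eq_of_rotation (Y := spinOp S 0) (c := Complex.I) (by simp) a (hneg c)
  · exact h2

theorem trace_spinOp_pow_four (i : Fin 3) :
    (spinOp S i ^ 4).trace =
      (2 * S + 1) * (S * (S + 1) * (3 * S ^ 2 + 3 * S - 1) / 15) := by
  have h2 : (spinOp S 2 ^ 4).trace =
      (2 * S + 1) * (S * (S + 1) * (3 * S ^ 2 + 3 * S - 1) / 15) := by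
    rw [spinOp_two, Matrix.diagonal_pow, Matrix.trace_diagonal, ← sum_spin_pow_four]
    rfl
  have a := spinOp_commutator_zero_one S
  have b := spinOp_commutator_one_two S
  have c := spinOp_commutator_two_zero S
  have hneg : ∀ {A B : SiteOp S} {C : SiteOp S}, A * B - B * A = Complex.I • C →
      B * A - A * B = -Complex.I • C := by
    intro A B C h
    rw [← neg_sub, h, neg_smul]
  fin_cases i
  · refine Eq.trans ?_ h2
    refine trace_pow_four_eq_of_rotation (Y := spinOp S 1) (c := -Complex.I) (by simp)
      (hneg a) ?_
    simpa using b
  · refine Eq.trans ?_ h2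
    exact trace_pow_four_eq_of_rotation (Y := spinOp S 0) (c := Complex.I) (by simp) a (hneg c)
  · exact h2

theorem trace_spinOp (i : Fin 3) : (spinOp S i).trace = 0 := by
  have key : ∀ {A B C : SiteOp S}, A * B - B * A = Complex.I • C → C.trace = 0 := by
    intro A B C h
    have := trace_commutator A B
    rw [h, Matrix.trace_smul, smul_eq_zero] at this
    exact this.resolve_left Complex.I_ne_zero
  fin_cases i
  · exact key (spinOp_commutator_one_two S)
  · exact key (spinOp_commutator_two_zero S)
  · exact key (spinOp_commutator_zero_one S)

theorem sum_spinOp_opp (i : Fin 3) :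
    ∑ a : Spin S, ∑ b : Spin S,
      (-1 : ℂ) ^ (a.1 + b.1) * spinOp S i a b * spinOp S i a.opp b.opp =
        -(spinOp S i ^ 2).trace := by
  simp only [sq, Matrix.trace, Matrix.diag, Matrix.mul_apply, ← Finset.sum_neg_distrib]
  refine Finset.sum_congr rfl fun a _ => Finset.sum_congr rfl fun b _ => ?_
  linear_combination spinOp S i a b * spinOp_opp S i a b

/-- The spin flip as a permutation. -/
def Spin.oppEquiv : Equiv.Perm (Spin S) where
  toFun := Spin.opp
  invFun := Spin.opp
  left_inv a := by simp [Spin.opp]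
  right_inv a := by simp [Spin.opp]

theorem spinOp_sq_opp (i : Fin 3) (a b : Spin S) :
    (-1 : ℂ) ^ (a.1 + b.1) * (spinOp S i ^ 2) a.opp b.opp = (spinOp S i ^ 2) b a := by
  simp only [sq, Matrix.mul_apply, Finset.mul_sum]
  rw [← (Equiv.sum_comp (Spin.oppEquiv S)
    fun c => (-1 : ℂ) ^ (a.1 + b.1) * (spinOp S i a.opp c * spinOp S i c b.opp))]
  refine Finset.sum_congr rfl fun c _ => ?_
  have h1 := spinOp_opp S i a c
  have h2 := spinOp_opp S i c b
  have h3 : (-1 : ℂ) ^ (a.1 + b.1) = (-1) ^ (a.1 + c.1) * (-1) ^ (c.1 + b.1) := by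
    rw [← zpow_add₀ (by norm_num), show a.1 + c.1 + (c.1 + b.1) = a.1 + b.1 + 2 * c.1 by ring,
      zpow_add₀ (by norm_num) (a.1 + b.1), zpow_mul]
    norm_num
  change _ * (spinOp S i a.opp c.opp * spinOp S i c.opp b.opp) = _
  rw [h3]
  linear_combination (-1 : ℂ) ^ (c.1 + b.1) * spinOp S i c.opp b.opp * h1 - spinOp S i c a * h2

/-- Squaring removes the minus sign of `spinOp_opp`, so opposite and equal directions get the same
coefficient; hence the covariance of the squares sees only `eventSame`. -/
theorem sum_spinOp_sq_opp (i : Fin 3) :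
    ∑ a : Spin S, ∑ b : Spin S,
      (-1 : ℂ) ^ (a.1 + b.1) * (spinOp S i ^ 2) a b * (spinOp S i ^ 2) a.opp b.opp =
        (spinOp S i ^ 4).trace := by
  rw [show spinOp S i ^ 4 = spinOp S i ^ 2 * spinOp S i ^ 2 by rw [← pow_add]]
  simp only [Matrix.trace, Matrix.diag, Matrix.mul_apply (M := spinOp S i ^ 2)]
  refine Finset.sum_congr rfl fun a _ => Finset.sum_congr rfl fun b _ => ?_
  linear_combination (spinOp S i ^ 2) a b * spinOp_sq_opp S i a b

end SpinOps

/-! ### Integration over the realizations -/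

theorem measurable_sigmaMk {ι : Type*} {X : ι → Type*} [∀ i, MeasurableSpace (X i)] (i : ι) :
    Measurable (Sigma.mk i : X i → Σ i, X i) :=
  measurable_iff_le_map.2 (iInf_le _ i)

theorem measurable_of_sigma {ι Y : Type*} {X : ι → Type*} [∀ i, MeasurableSpace (X i)]
    [MeasurableSpace Y] {F : (Σ i, X i) → Y} (h : ∀ i, Measurable fun v : X i => F ⟨i, v⟩) :
    Measurable F := by
  intro s hs
  rw [MeasurableSpace.measurableSet_iInf]
  exact fun i => h i hs

theorem measurable_apply_countable {X Y ι : Type*} [MeasurableSpace X] [MeasurableSpace Y]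
    [Countable ι] {p : X → ι} (hp : ∀ i, MeasurableSet (p ⁻¹' {i})) {F : ι → X → Y}
    (hF : ∀ i, Measurable (F i)) : Measurable fun x => F (p x) x := by
  let _ : MeasurableSpace ι := ⊤
  have h : Measurable fun z : ι × X => F z.1 z.2 := measurable_from_prod_countable_right hF
  exact h.comp ((measurable_to_countable' hp).prodMk measurable_id)

theorem measurableSet_sort (n : ℕ) (π : Equiv.Perm (Fin n)) :
    MeasurableSet {t : Fin n → ℝ | Tuple.sort t = π} := by
  have : {t : Fin n → ℝ | Tuple.sort t = π} = {t | (∀ i j, i ≤ j → t (π i) ≤ t (π j)) ∧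
      ∀ i j, i < j → t (π i) = t (π j) → π i < π j} := by
    ext t
    exact eq_comm.trans Tuple.eq_sort_iff
  rw [this, measurableSet_setOfPred]
  refine .and (.forall fun i => .forall fun j => .imp measurable_const ?_)
    (.forall fun i => .forall fun j => .imp measurable_const (.imp ?_ measurable_const))
  · exact measurableSet_setOfPred.1 (measurableSet_le (measurable_pi_apply _) (measurable_pi_apply _))
  · exact measurableSet_setOfPred.1
      (measurableSet_eq_fun (measurable_pi_apply _) (measurable_pi_apply _))

instance : Fintype Kind where
  elems := ⟨{Kind.cross, Kind.doubleBar}, by simp⟩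
  complete k := by cases k <;> simp

theorem sum_kind {M : Type*} [AddCommMonoid M] (F : Kind → M) :
    ∑ k, F k = F Kind.cross + F Kind.doubleBar := by
  change (Multiset.map F {Kind.cross, Kind.doubleBar}).sum = _
  simp

/-! ### Loops depend only on the ordered word of transitions. -/

section Words

variable {Λ : Type*} (G : SimpleGraph Λ)

/-- An edge and a kind of transition. -/
abbrev Letter : Type _ := G.edgeSet × Kind

variable {G}

/-- The edges and kinds of the transitions of a realization, in the order of times. -/
def word (ω : Realization G) : Fin ω.1 → Letter G :=
  fun k => ((nthEvent ω k).1, (nthEvent ω k).2.1)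

/-- A realization with a given word. -/
def realize {n : ℕ} (w : Fin n → Letter G) : Realization G :=
  -- Any strictly increasing times would do; they need not lie in `[0, β]`.
  ⟨n, fun k => ((w k).1, (w k).2, ((k : ℕ) : ℝ))⟩

theorem word_realize {n : ℕ} (w : Fin n → Letter G) : word (realize w) = w := by
  funext k
  have : Tuple.sort (fun i : Fin n => ((i : ℕ) : ℝ)) = Equiv.refl _ := by
    rw [Tuple.sort_eq_refl_iff_monotone]
    intro i j h
    exact Nat.cast_le.2 h
  simp only [word, nthEvent, realize, this]
  rfl

theorem nthEdge_realize {n : ℕ} (w : Fin n → Letter G) (k : Fin n) :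
    nthEdge (realize w) k = (w k).1.1 :=
  congrArg (fun c : Letter G => c.1.1) (congrFun (word_realize w) k)

theorem nthKind_realize {n : ℕ} (w : Fin n → Letter G) (k : Fin n) :
    nthKind (realize w) k = (w k).2 :=
  congrArg Prod.snd (congrFun (word_realize w) k)

theorem link_of_word_eq {ω : Realization G} {v' : Fin ω.1 → Event G}
    (h : word ω = word (⟨ω.1, v'⟩ : Realization G)) {a b : DirPiece ω} (hab : Link ω a b) :
    Link (⟨ω.1, v'⟩ : Realization G) a b := by
  have he : ∀ k, nthEdge ω k = nthEdge (⟨ω.1, v'⟩ : Realization G) k :=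
    fun k => congrArg (fun c : Letter G => c.1.1) (congrFun h k)
  have hk : ∀ k, nthKind ω k = nthKind (⟨ω.1, v'⟩ : Realization G) k :=
    fun k => congrArg Prod.snd (congrFun h k)
  cases hab with
  | through k z d hz => exact Link.through (ω := ⟨ω.1, v'⟩) k z d (he k ▸ hz)
  | cross k x y d h1 h2 => exact Link.cross (ω := ⟨ω.1, v'⟩) k x y d (he k ▸ h1) (hk k ▸ h2)
  | barBelow k x y d h1 h2 =>
    exact Link.barBelow (ω := ⟨ω.1, v'⟩) k x y d (he k ▸ h1) (hk k ▸ h2)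
  | barAbove k x y d h1 h2 =>
    exact Link.barAbove (ω := ⟨ω.1, v'⟩) k x y d (he k ▸ h1) (hk k ▸ h2)
  | periodic x d => exact Link.periodic (ω := ⟨ω.1, v'⟩) x d

theorem link_congr {n : ℕ} {v v' : Fin n → Event G}
    (h : word ⟨n, v⟩ = word (⟨n, v'⟩ : Realization G)) :
    (Link (⟨n, v⟩ : Realization G) : (Λ × Fin (n + 1)) × Bool → _ → Prop) =
      Link (⟨n, v'⟩ : Realization G) := by
  funext a b
  exact propext ⟨link_of_word_eq (ω := ⟨n, v⟩) h, link_of_word_eq (ω := ⟨n, v'⟩) h.symm⟩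

theorem sameDirLoop_congr {n : ℕ} {v v' : Fin n → Event G}
    (h : word ⟨n, v⟩ = word (⟨n, v'⟩ : Realization G)) (a b : (Λ × Fin (n + 1)) × Bool) :
    SameDirLoop (⟨n, v⟩ : Realization G) a b ↔ SameDirLoop (⟨n, v'⟩ : Realization G) a b := by
  change Relation.EqvGen (Link (⟨n, v⟩ : Realization G)) a b ↔
    Relation.EqvGen (Link (⟨n, v'⟩ : Realization G)) a b
  rw [link_congr h]

theorem numLoops_congr {n : ℕ} {v v' : Fin n → Event G}
    (h : word ⟨n, v⟩ = word (⟨n, v'⟩ : Realization G)) :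
    numLoops (⟨n, v⟩ : Realization G) = numLoops (⟨n, v'⟩ : Realization G) := by
  change Nat.card (Quot fun p q : Λ × Fin (n + 1) =>
      ∃ d d', Link (⟨n, v⟩ : Realization G) (p, d) (q, d')) =
    Nat.card (Quot fun p q : Λ × Fin (n + 1) =>
      ∃ d d', Link (⟨n, v'⟩ : Realization G) (p, d) (q, d'))
  rw [link_congr h]

/-- Events that depend on the edges, the kinds and the order of the transitions only. -/
def IsWordEvent (E : Set (Realization G)) : Prop :=
  ∀ (n : ℕ) (v v' : Fin n → Event G), word ⟨n, v⟩ = word (⟨n, v'⟩ : Realization G) →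
    ((⟨n, v⟩ : Realization G) ∈ E ↔ (⟨n, v'⟩ : Realization G) ∈ E)

theorem isWordEvent_eventPlus (x y : Λ) : IsWordEvent (eventPlus G x y) :=
  fun _ _ _ h => sameDirLoop_congr h _ _

theorem isWordEvent_eventMinus (x y : Λ) : IsWordEvent (eventMinus G x y) :=
  fun _ _ _ h => sameDirLoop_congr h _ _

theorem isWordEvent_eventSame (x y : Λ) : IsWordEvent (eventSame G x y) :=
  fun n v v' h =>
    or_congr (isWordEvent_eventPlus x y n v v' h) (isWordEvent_eventMinus x y n v v' h)

theorem IsWordEvent.compl {E : Set (Realization G)} (hE : IsWordEvent E) : IsWordEvent Eᶜ :=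
  fun n v v' h => not_congr (hE n v v' h)

theorem loopWeight_realize_word (S : ℕ) {E : Set (Realization G)} (hE : IsWordEvent E)
    (ω : Realization G) : loopWeight S E (realize (word ω)) = loopWeight S E ω := by
  obtain ⟨n, v⟩ := ω
  have h : word (realize (word (⟨n, v⟩ : Realization G))) = word (⟨n, v⟩ : Realization G) :=
    word_realize _
  have h1 : realize (word (⟨n, v⟩ : Realization G)) ∈ E ↔ (⟨n, v⟩ : Realization G) ∈ E :=
    hE n _ v h
  have h2 : numLoops (realize (word (⟨n, v⟩ : Realization G))) =
    numLoops (⟨n, v⟩ : Realization G) := numLoops_congr h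
  by_cases hm : (⟨n, v⟩ : Realization G) ∈ E
  · rw [loopWeight, loopWeight, Set.indicator_of_mem hm, Set.indicator_of_mem (h1.2 hm), h2]
  · rw [loopWeight, loopWeight, Set.indicator_of_notMem hm,
      Set.indicator_of_notMem (fun h' => hm (h1.1 h'))]

variable [Fintype Λ]

theorem numLoops_le (ω : Realization G) : numLoops ω ≤ Fintype.card Λ * (ω.1 + 1) := by
  refine (Nat.card_le_card_of_surjective (Quot.mk _ : Piece ω → LoopSet ω)
    Quot.mk_surjective).trans ?_
  simp [Nat.card_eq_fintype_card]

/-- Geometric growth in the number of transitions is all that the factor `1 / n!` needs for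
integrability. -/
theorem abs_loopWeight_le (S : ℕ) (E : Set (Realization G)) (ω : Realization G) :
    |loopWeight S E ω| ≤ (2 * S + 1 : ℝ) ^ Fintype.card Λ *
      ((2 * S + 1 : ℝ) ^ Fintype.card Λ) ^ ω.1 := by
  have h1 : (1 : ℝ) ≤ 2 * S + 1 := by linarith [Nat.cast_nonneg (α := ℝ) S]
  rw [← pow_succ', ← pow_mul]
  by_cases hm : ω ∈ E
  · rw [loopWeight, Set.indicator_of_mem hm, abs_of_nonneg (by positivity)]
    exact pow_le_pow_right₀ h1 (numLoops_le ω)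
  · rw [loopWeight, Set.indicator_of_notMem hm, abs_zero]
    positivity

end Words

/-! ### Poisson integrals of functions of the word. -/

section Poisson

variable {Λ : Type*} [Fintype Λ] (G : SimpleGraph Λ) [DecidableRel G.Adj]

/-- The rate of a kind of transition. -/
def rate (u : ℝ) : Kind → ℝ
  | Kind.cross => u
  | Kind.doubleBar => 1 - u

/-- The law of the kinds of transitions. -/
def kindMeasure (u : ℝ) : Measure Kind :=
  ENNReal.ofReal u • Measure.dirac Kind.cross + ENNReal.ofReal (1 - u) • Measure.dirac Kind.doubleBar

instance (u : ℝ) : IsFiniteMeasure (kindMeasure u) := by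
  constructor
  simp [kindMeasure]

theorem kindMeasure_singleton (u : ℝ) (k : Kind) :
    kindMeasure u {k} = ENNReal.ofReal (rate u k) := by
  cases k <;> simp [kindMeasure, rate]

theorem rate_nonneg {u : ℝ} (hu : u ∈ Set.Icc (0 : ℝ) 1) (k : Kind) : 0 ≤ rate u k := by
  cases k
  · exact hu.1
  · exact sub_nonneg.2 hu.2

/-- The intensity of edges and kinds. -/
def letterMeasure (u : ℝ) : Measure (Letter G) := Measure.count.prod (kindMeasure u)

instance (u : ℝ) : IsFiniteMeasure (letterMeasure G u) := by
  unfold letterMeasure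
  infer_instance

theorem letterMeasure_singleton (u : ℝ) (c : Letter G) :
    letterMeasure G u {c} = ENNReal.ofReal (rate u c.2) := by
  rw [letterMeasure, ← Set.singleton_prod_singleton, Measure.prod_prod, Measure.count_singleton,
    one_mul, kindMeasure_singleton]

instance (u β : ℝ) : IsFiniteMeasure (intensity G u β) := by
  change IsFiniteMeasure (Measure.count.prod
    ((kindMeasure u).prod (volume.restrict (Set.Icc 0 β))))
  infer_instance

theorem intensity_univ {u β : ℝ} (hu : u ∈ Set.Icc (0 : ℝ) 1) (hβ : 0 ≤ β) :
    (intensity G u β Set.univ).toReal = G.edgeFinset.card * β := by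
  have h1 : (kindMeasure u) Set.univ = 1 := by
    simp only [kindMeasure, Measure.add_apply, Measure.smul_apply, measure_univ, smul_eq_mul,
      mul_one]
    rw [← ENNReal.ofReal_add hu.1 (sub_nonneg.2 hu.2)]
    simp
  change ((Measure.count.prod ((kindMeasure u).prod (volume.restrict (Set.Icc 0 β))))
    Set.univ).toReal = _
  rw [← Set.univ_prod_univ, Measure.prod_prod, ← Set.univ_prod_univ, Measure.prod_prod, h1,
    Measure.restrict_apply_univ, Real.volume_Icc, Measure.count_apply_finite _ Set.finite_univ]
  simp only [one_mul, sub_zero, ENNReal.toReal_mul, ENNReal.toReal_ofReal hβ]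
  congr 1
  simp [← SimpleGraph.card_edgeSet, Fintype.card_subtype]

/-- Splitting the times off. -/
theorem measurePreserving_split (u β : ℝ) (n : ℕ) :
    MeasurePreserving (fun z : (Fin n → Letter G) × (Fin n → ℝ) =>
        fun i => (((z.1 i).1, (z.1 i).2, z.2 i) : Event G))
      ((Measure.pi fun _ => letterMeasure G u).prod
        (Measure.pi fun _ => volume.restrict (Set.Icc 0 β)))
      (Measure.pi fun _ => intensity G u β) := by
  have h1 := measurePreserving_prodAssoc (Measure.count : Measure G.edgeSet) (kindMeasure u)
    (volume.restrict (Set.Icc 0 β))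
  have h2 := measurePreserving_pi (fun _ : Fin n => (letterMeasure G u).prod
    (volume.restrict (Set.Icc 0 β))) (fun _ : Fin n => intensity G u β) (fun _ => h1)
  have h3 := measurePreserving_arrowProdEquivProdArrow (Letter G) ℝ (Fin n)
    (fun _ => letterMeasure G u) (fun _ => volume.restrict (Set.Icc 0 β))
  exact h2.comp h3.symm

variable {G}

theorem measurable_word (n : ℕ) :
    Measurable (α := Fin n → Event G) (β := Fin n → Letter G)
    (fun v => word (⟨n, v⟩ : Realization G)) := by
  refine measurable_apply_countable
    (p := fun v : Fin n → Event G => Tuple.sort fun i => (v i).2.2)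
    (F := fun π v k => ((v (π k)).1, (v (π k)).2.1)) (fun π => ?_) (fun π => ?_)
  · have : Measurable fun (v : Fin n → Event G) (i : Fin n) => (v i).2.2 := by fun_prop
    exact this (measurableSet_sort n π)
  · refine measurable_pi_iff.2 fun k => ?_
    fun_prop

variable (Ψ : ∀ n : ℕ, (Fin n → Letter G) → ℝ)

theorem measurable_word_function : Measurable fun ω : Realization G => Ψ ω.1 (word ω) :=
  measurable_of_sigma fun n => (Measurable.of_discrete (f := Ψ n)).comp (measurable_word n)

theorem integral_letters {u : ℝ} (hu : u ∈ Set.Icc (0 : ℝ) 1) (n : ℕ)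
    (F : (Fin n → Letter G) → ℝ) :
    ∫ c, F c ∂(Measure.pi fun _ => letterMeasure G u) =
      ∑ w : Fin n → Letter G, (∏ k, rate u (w k).2) * F w := by
  rw [integral_fintype .of_finite]
  refine Finset.sum_congr rfl fun w _ => ?_
  rw [Measure.real, Measure.pi_singleton, smul_eq_mul]
  simp only [letterMeasure_singleton, ENNReal.toReal_prod,
    ENNReal.toReal_ofReal (rate_nonneg hu _)]

/-- For fixed times, sorting only permutes the letters, and the product law of the letters is
exchangeable. The integral over letters is then independent of the times, which contribute `β ^ n`.
-/
theorem integral_word {u β : ℝ} (hu : u ∈ Set.Icc (0 : ℝ) 1) (hβ : 0 ≤ β) (n : ℕ) :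
    ∫ v, Ψ n (word (⟨n, v⟩ : Realization G)) ∂(Measure.pi fun _ : Fin n => intensity G u β) =
      β ^ n * ∑ w : Fin n → Letter G, (∏ k, rate u (w k).2) * Ψ n w := by
  have hmp := measurePreserving_split G u β n
  have hmeas : Measurable fun v : Fin n → Event G => Ψ n (word (⟨n, v⟩ : Realization G)) :=
    (Measurable.of_discrete (f := Ψ n)).comp (measurable_word n)
  rw [← hmp.map_eq, integral_map hmp.measurable.aemeasurable hmeas.aestronglyMeasurable]
  have hword : ∀ (c : Fin n → Letter G) (t : Fin n → ℝ),
      word (⟨n, fun i => ((c i).1, (c i).2, t i)⟩ : Realization G) = c ∘ Tuple.sort t :=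
    fun c t => rfl
  rw [integral_prod_symm]
  · simp only [hword]
    have hperm : ∀ π : Equiv.Perm (Fin n),
        ∫ c, Ψ n (c ∘ π) ∂(Measure.pi fun _ => letterMeasure G u) =
          ∑ w : Fin n → Letter G, (∏ k, rate u (w k).2) * Ψ n w := by
      intro π
      rw [integral_letters hu]
      refine Fintype.sum_equiv (Equiv.arrowCongr π.symm (Equiv.refl _)) _ _ fun w => ?_
      have : ∀ k, (Equiv.arrowCongr π.symm (Equiv.refl (Letter G))) w k = w (π k) := fun k => rfl
      simp only [this]
      rw [Equiv.prod_comp π fun k => rate u (w k).2]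
      rfl
    simp only [hperm]
    rw [integral_const, smul_eq_mul, Measure.real, Measure.pi_univ]
    congr 1
    simp [ENNReal.toReal_ofReal hβ]
  · obtain ⟨K, hK⟩ : ∃ K, ∀ w, ‖Ψ n w‖ ≤ K := by
      refine ⟨∑ w, ‖Ψ n w‖, fun w => ?_⟩
      exact Finset.single_le_sum (f := fun w => ‖Ψ n w‖) (fun _ _ => norm_nonneg _)
        (Finset.mem_univ w)
    exact .of_bound (hmeas.comp hmp.measurable).aestronglyMeasurable K (.of_forall fun z => hK _)

/-- The expectation of a function of the transitions in their order. -/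
theorem hasSum_integral_rho {u β : ℝ} (hu : u ∈ Set.Icc (0 : ℝ) 1) (hβ : 0 ≤ β) {K C : ℝ}
    (hΨ : ∀ n w, |Ψ n w| ≤ K * C ^ n) :
    HasSum (fun n : ℕ => Real.exp (-(G.edgeFinset.card * β)) *
        (β ^ n / n ! * ∑ w : Fin n → Letter G, (∏ k, rate u (w k).2) * Ψ n w))
      (∫ ω, Ψ ω.1 (word ω) ∂(rho G u β)) := by
  have hmeas := measurable_word_function Ψ
  have hmk : ∀ n, Measurable (fun v : Fin n → Event G => (⟨n, v⟩ : Realization G)) :=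
    fun n => measurable_sigmaMk n
  have hterm : ∀ n, 0 ≤ Real.exp (-(G.edgeFinset.card * β)) / (n ! : ℝ) :=
    fun n => by positivity
  have hint : Integrable (fun ω : Realization G => Ψ ω.1 (word ω)) (rho G u β) := by
    refine integrable_sum_measure (fun n => ?_) ?_
    · refine Integrable.smul_measure ?_ ENNReal.ofReal_ne_top
      rw [integrable_map_measure hmeas.aestronglyMeasurable (hmk n).aemeasurable]
      exact .of_bound (hmeas.comp (hmk n)).aestronglyMeasurable (K * C ^ n)
        (.of_forall fun v => hΨ _ _)
    · refine Summable.of_nonneg_of_le (fun n => integral_nonneg fun _ => norm_nonneg _)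
        (fun n => ?_) ((Real.summable_pow_div_factorial (C * (G.edgeFinset.card * β))).mul_left
          (K * Real.exp (-(G.edgeFinset.card * β))))
      rw [integral_smul_measure, integral_map (hmk n).aemeasurable
        hmeas.norm.aestronglyMeasurable, intensity_univ G hu hβ, ENNReal.toReal_ofReal (hterm n)]
      have h1 : ∫ v : Fin n → Event G, ‖Ψ n (word (⟨n, v⟩ : Realization G))‖
          ∂(Measure.pi fun _ => intensity G u β) ≤ K * C ^ n * (G.edgeFinset.card * β) ^ n := by
        refine (integral_mono_of_nonneg (.of_forall fun _ => norm_nonneg _)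
          (integrable_const (K * C ^ n)) (.of_forall fun v => hΨ _ _)).trans ?_
        rw [integral_const, smul_eq_mul, Measure.real, Measure.pi_univ]
        simp [intensity_univ G hu hβ, mul_comm]
      refine (mul_le_mul_of_nonneg_left h1 (hterm n)).trans_eq ?_
      rw [mul_pow]
      ring
  have h := hasSum_integral_measure hint
  refine h.congr_fun ?_
  intro n
  rw [integral_smul_measure, integral_map (hmk n).aemeasurable hmeas.aestronglyMeasurable,
    intensity_univ G hu hβ, ENNReal.toReal_ofReal (hterm n), integral_word Ψ hu hβ n, smul_eq_mul]
  ring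

end Poisson

/-! ### Expansion of the Gibbs operator -/

theorem sum_pow_eq_sum_words {R C : Type*} [Semiring R] [Fintype C] (X : C → R) (n : ℕ) :
    (∑ c, X c) ^ n = ∑ w : Fin n → C, (List.ofFn fun k => X (w k)).prod := by
  induction n with
  | zero => simp
  | succ n ih =>
    rw [pow_succ', ih, Finset.sum_mul_sum, ← (Fin.consEquiv fun _ => C).sum_comp,
      Fintype.sum_prod_type]
    refine Finset.sum_congr rfl fun c _ => Finset.sum_congr rfl fun w _ => ?_
    simp [Fin.consEquiv, List.ofFn_succ]

theorem prod_ofFn_smul {R : Type*} [Ring R] [Algebra ℂ R] (n : ℕ) (a : Fin n → ℂ)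
    (X : Fin n → R) :
    (List.ofFn fun k => a k • X k).prod = (∏ k, a k) • (List.ofFn X).prod := by
  induction n with
  | zero => simp
  | succ n ih =>
    simp only [List.ofFn_succ, List.prod_cons, ih, Fin.prod_univ_succ, Algebra.smul_mul_assoc,
      Algebra.mul_smul_comm, smul_smul, mul_comm]

section Exp

variable {n : Type*} [Fintype n] [DecidableEq n]

attribute [local instance] Matrix.linftyOpNormedRing Matrix.linftyOpNormedAlgebra in
theorem hasSum_trace_mul_exp (O X : Matrix n n ℂ) :
    HasSum (fun k : ℕ => (k ! : ℂ)⁻¹ * (O * X ^ k).trace) (O * NormedSpace.exp X).trace := by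
  have h := NormedSpace.exp_series_hasSum_exp' (𝕂 := ℂ) X
  have h2 := h.map ((Matrix.traceAddMonoidHom n ℂ).comp (AddMonoidHom.mulLeft O)) (by
    change Continuous fun Y : Matrix n n ℂ => (O * Y).trace
    fun_prop)
  refine h2.congr_fun ?_
  intro k
  simp

theorem exp_scalar_add (c : ℂ) (X : Matrix n n ℂ) :
    NormedSpace.exp (c • (1 : Matrix n n ℂ) + X) = Complex.exp c • NormedSpace.exp X := by
  rw [Matrix.exp_add_of_commute _ _ ((Commute.one_left X).smul_left c),
    Matrix.smul_one_eq_diagonal, Matrix.exp_diagonal]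
  have : NormedSpace.exp (fun _ : n => c) = fun _ => Complex.exp c := by
    funext i
    rw [Pi.coe_exp, Complex.exp_eq_exp_ℂ]
  rw [this, ← Matrix.smul_one_eq_diagonal, smul_mul_assoc, one_mul]

end Exp

/-! ### Comparison of the Gibbs and Poisson series. -/

section Final

variable {Λ : Type*} [Fintype Λ] [DecidableEq Λ] (G : SimpleGraph Λ) [DecidableRel G.Adj]
  (S : ℕ) (u β : ℝ)

/-- The constant `-1` on each edge yields the prefactor that normalizes a Poisson process of total
mass `|E| β`. -/
theorem gibbs_eq : gibbs G S u β 0 = Complex.exp (-(G.edgeFinset.card * β)) •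
    NormedSpace.exp ((β : ℂ) •
      ∑ c : Letter G, (rate u c.2 : ℂ) • transitionOp S c.1.1 c.2) := by
  rw [gibbs, ← exp_scalar_add]
  congr 1
  have h : ∑ c : Letter G, (rate u c.2 : ℂ) • transitionOp S c.1.1 c.2 =
      ∑ e ∈ G.edgeFinset, ((u : ℂ) • transOp S e + ((1 - u : ℝ) : ℂ) • singletOp S e) := by
    rw [Fintype.sum_prod_type]
    simp only [sum_kind]
    symm
    exact Finset.sum_subtype G.edgeFinset (fun e => SimpleGraph.mem_edgeFinset) _
  rw [h, hamiltonian, Finset.sum_sub_distrib, Finset.sum_const]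
  simp only [Pi.zero_apply, Complex.ofReal_zero, zero_smul, Finset.sum_const_zero, sub_zero,
    ← Nat.cast_smul_eq_nsmul ℂ]
  module

theorem transitionProd_realize {n : ℕ} (w : Fin n → Letter G) :
    transitionProd (realize w) S =
      (List.ofFn fun k => transitionOp S (w k).1.1 (w k).2).prod := by
  have : ∀ k : Fin n, transitionOp S (nthEdge (realize w) k) (nthKind (realize w) k) =
      transitionOp S (w k).1.1 (w k).2 := fun k => by
    rw [nthEdge_realize, nthKind_realize]
  change (List.ofFn fun k : Fin n =>
    transitionOp S (nthEdge (realize w) k) (nthKind (realize w) k)).prod = _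
  rw [funext this]

theorem hasSum_trace_gibbs (O : ManyOp Λ S) :
    HasSum (fun n : ℕ => Complex.exp (-(G.edgeFinset.card * β)) *
        ((β : ℂ) ^ n / n ! * ∑ w : Fin n → Letter G, (∏ k, (rate u (w k).2 : ℂ)) *
          (O * transitionProd (realize w) S).trace))
      (O * gibbs G S u β 0).trace := by
  rw [gibbs_eq, Matrix.mul_smul, Matrix.trace_smul, smul_eq_mul]
  refine ((hasSum_trace_mul_exp O _).mul_left _).congr_fun fun n => ?_
  rw [smul_pow, sum_pow_eq_sum_words]
  simp only [prod_ofFn_smul, transitionProd_realize, Finset.smul_sum, Finset.mul_sum,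
    Matrix.trace_sum, Matrix.mul_smul, Matrix.trace_smul, smul_eq_mul]
  refine Finset.sum_congr rfl fun w _ => ?_
  ring

/-- The integral `∫ 1_E (2S+1)^|𝓛| dρ`. -/
def loopIntegral (E : Set (Realization G)) : ℝ :=
  ∫ ω, E.indicator (fun ω => ((2 * S + 1 : ℝ)) ^ numLoops ω) ω ∂(rho G u β)

theorem loopProb_eq (E : Set (Realization G)) : loopProb G S u β E =
    1 / partitionFunction G S u β 0 * (loopIntegral G S u β E : ℂ) := rfl

variable {u β}

theorem hasSum_loopIntegral (hu : u ∈ Set.Icc (0 : ℝ) 1) (hβ : 0 ≤ β)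
    {E : Set (Realization G)} (hE : IsWordEvent E) :
    HasSum (fun n : ℕ => Real.exp (-(G.edgeFinset.card * β)) *
        (β ^ n / n ! * ∑ w : Fin n → Letter G, (∏ k, rate u (w k).2) *
          loopWeight S E (realize w)))
      (loopIntegral G S u β E) := by
  have h := hasSum_integral_rho (G := G) (fun n w => loopWeight S E (realize w)) hu hβ
    (fun n w => abs_loopWeight_le S E (realize w))
  simp only [loopWeight_realize_word S hE] at h
  exact h

theorem hasSum_loopIntegral_complex (hu : u ∈ Set.Icc (0 : ℝ) 1) (hβ : 0 ≤ β)
    {E : Set (Realization G)} (hE : IsWordEvent E) :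
    HasSum (fun n : ℕ => Complex.exp (-(G.edgeFinset.card * β)) *
        ((β : ℂ) ^ n / n ! * ∑ w : Fin n → Letter G, (∏ k, (rate u (w k).2 : ℂ)) *
          (loopWeight S E (realize w) : ℂ)))
      (loopIntegral G S u β E : ℂ) := by
  have h := Complex.hasSum_ofReal.2 (hasSum_loopIntegral G S hu hβ hE)
  refine h.congr_fun fun n => ?_
  push_cast
  rfl

/-- Both sides are sums of series that agree term by term by `trace_eq_loopWeight`. -/
theorem trace_gibbs_eq (hu : u ∈ Set.Icc (0 : ℝ) 1) (hβ : 0 ≤ β)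
    {x y : Λ} (hxy : x ≠ y) (A B : SiteOp S) :
    (onSite x A * onSite y B * gibbs G S u β 0).trace =
      1 / (2 * (S : ℂ) + 1) * (A * B).trace * loopIntegral G S u β (eventPlus G x y) +
      1 / (2 * (S : ℂ) + 1) * (∑ a : Spin S, ∑ b : Spin S,
        (-1 : ℂ) ^ (a.1 + b.1) * A a b * B a.opp b.opp) *
          loopIntegral G S u β (eventMinus G x y) +
      1 / (2 * (S : ℂ) + 1) ^ 2 * A.trace * B.trace *
        loopIntegral G S u β (eventSame G x y)ᶜ := by
  refine (hasSum_trace_gibbs G S u β _).unique ?_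
  have h1 := hasSum_loopIntegral_complex G S hu hβ (isWordEvent_eventPlus (G := G) x y)
  have h2 := hasSum_loopIntegral_complex G S hu hβ (isWordEvent_eventMinus (G := G) x y)
  have h3 := hasSum_loopIntegral_complex G S hu hβ (isWordEvent_eventSame (G := G) x y).compl
  refine (((h1.mul_left _).add (h2.mul_left _)).add (h3.mul_left _)).congr_fun fun n => ?_
  simp only [trace_eq_loopWeight _ hxy A B, Finset.mul_sum, ← Finset.sum_add_distrib]
  refine Finset.sum_congr rfl fun w _ => ?_
  ring

theorem partitionFunction_eq (hu : u ∈ Set.Icc (0 : ℝ) 1) (hβ : 0 ≤ β)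
    {x y : Λ} (hxy : x ≠ y) :
    partitionFunction G S u β 0 = (loopIntegral G S u β Set.univ : ℂ) := by
  have h : partitionFunction G S u β 0 =
      (onSite x (1 : SiteOp S) * onSite y 1 * gibbs G S u β 0).trace := by
    rw [onSite_one, onSite_one, one_mul, one_mul, partitionFunction]
  rw [h]
  refine (hasSum_trace_gibbs G S u β _).unique ?_
  refine (hasSum_loopIntegral_complex G S hu hβ (E := Set.univ)
    fun _ _ _ _ => Iff.rfl).congr_fun fun n => ?_
  simp only [trace_one_mul_transitionProd _ hxy]
  simp [loopWeight]

theorem loopIntegral_univ_pos (hu : u ∈ Set.Icc (0 : ℝ) 1) (hβ : 0 ≤ β) :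
    0 < loopIntegral G S u β Set.univ := by
  have h := hasSum_loopIntegral G S hu hβ (E := Set.univ) fun _ _ _ _ => Iff.rfl
  -- All terms are nonnegative, and the empty word already contributes a positive one.
  refine lt_of_lt_of_le ?_ (le_hasSum h 0 fun n _ => ?_)
  · simp only [loopWeight, Set.indicator_univ]
    simp
    positivity
  · have : ∀ w : Fin n → Letter G, 0 ≤ ∏ k, rate u (w k).2 :=
      fun w => Finset.prod_nonneg fun k _ => rate_nonneg hu _
    simp only [loopWeight, Set.indicator_univ]
    refine mul_nonneg (Real.exp_pos _).le (mul_nonneg (by positivity)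
      (Finset.sum_nonneg fun w _ => mul_nonneg (this w) (by positivity)))

theorem partitionFunction_ne_zero (hu : u ∈ Set.Icc (0 : ℝ) 1) (hβ : 0 ≤ β)
    {x y : Λ} (hxy : x ≠ y) : partitionFunction G S u β 0 ≠ 0 := by
  rw [partitionFunction_eq G S hu hβ hxy]
  exact_mod_cast (loopIntegral_univ_pos G S hu hβ).ne'

theorem expect_onSite_mul_onSite (hu : u ∈ Set.Icc (0 : ℝ) 1) (hβ : 0 ≤ β)
    {x y : Λ} (hxy : x ≠ y) (A B : SiteOp S) :
    expect G S u β (onSite x A * onSite y B) =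
      1 / (2 * (S : ℂ) + 1) * (A * B).trace * loopProb G S u β (eventPlus G x y) +
      1 / (2 * (S : ℂ) + 1) * (∑ a : Spin S, ∑ b : Spin S,
        (-1 : ℂ) ^ (a.1 + b.1) * A a b * B a.opp b.opp) * loopProb G S u β (eventMinus G x y) +
      1 / (2 * (S : ℂ) + 1) ^ 2 * A.trace * B.trace * loopProb G S u β (eventSame G x y)ᶜ := by
  rw [expect, trace_gibbs_eq G S hu hβ hxy]
  simp only [loopProb_eq]
  ring

theorem loopProb_add (hu : u ∈ Set.Icc (0 : ℝ) 1) (hβ : 0 ≤ β)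
    {x y : Λ} (hxy : x ≠ y) :
    loopProb G S u β (eventPlus G x y) + loopProb G S u β (eventMinus G x y) +
      loopProb G S u β (eventSame G x y)ᶜ = 1 := by
  have h := expect_onSite_mul_onSite G S hu hβ hxy 1 1
  have hN := two_mul_add_one_ne_zero S
  rw [onSite_one, onSite_one, expect, one_mul, one_mul, ← partitionFunction,
    one_div_mul_cancel (partitionFunction_ne_zero G S hu hβ hxy), sum_one_opp, mul_one,
    Matrix.trace_one, card_spin_cast] at h
  rw [h]
  field_simp

theorem loopProb_eventSame (hu : u ∈ Set.Icc (0 : ℝ) 1) (hβ : 0 ≤ β)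
    {x y : Λ} :
    loopProb G S u β (eventSame G x y) =
      loopProb G S u β (eventPlus G x y) + loopProb G S u β (eventMinus G x y) := by
  have h1 := hasSum_loopIntegral G S hu hβ (isWordEvent_eventPlus (G := G) x y)
  have h2 := hasSum_loopIntegral G S hu hβ (isWordEvent_eventMinus (G := G) x y)
  have h3 := hasSum_loopIntegral G S hu hβ (isWordEvent_eventSame (G := G) x y)
  have : loopIntegral G S u β (eventSame G x y) =
      loopIntegral G S u β (eventPlus G x y) + loopIntegral G S u β (eventMinus G x y) := by
    refine h3.unique ((h1.add h2).congr_fun fun n => ?_)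
    have hw : ∀ w : Fin n → Letter G, loopWeight S (eventSame G x y) (realize w) =
        loopWeight S (eventPlus G x y) (realize w) +
          loopWeight S (eventMinus G x y) (realize w) := by
      intro w
      have hd : Disjoint (eventPlus G x y) (eventMinus G x y) :=
        Set.disjoint_left.2 fun ω => not_mem_eventMinus_of_mem_eventPlus ω
      simp only [loopWeight, eventSame, Set.indicator_union_of_disjoint hd]
    simp only [hw, mul_add, Finset.sum_add_distrib]
  simp only [loopProb_eq, this]
  push_cast
  ring

/-- Insert the identity at the other site: the three coefficients coincide and the probabilities add
up to one. -/
theorem expect_onSite (hu : u ∈ Set.Icc (0 : ℝ) 1) (hβ : 0 ≤ β)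
    {x y : Λ} (hxy : x ≠ y) (A : SiteOp S) :
    expect G S u β (onSite x A) = 1 / (2 * (S : ℂ) + 1) * A.trace ∧
      expect G S u β (onSite y A) = 1 / (2 * (S : ℂ) + 1) * A.trace := by
  have key : ∀ {x y : Λ}, x ≠ y →
      expect G S u β (onSite x A) = 1 / (2 * (S : ℂ) + 1) * A.trace := by
    intro x y hxy
    have h := expect_onSite_mul_onSite G S hu hβ hxy A 1
    have hN := two_mul_add_one_ne_zero S
    have hs : (∑ a : Spin S, ∑ b : Spin S, (-1 : ℂ) ^ (a.1 + b.1) * A a b *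
        (1 : SiteOp S) a.opp b.opp) = A.trace := by
      simp [Matrix.one_apply, Spin.opp_inj, ← Spin.sgn_mul_sgn, Matrix.trace]
    rw [onSite_one, mul_one, mul_one, hs, Matrix.trace_one, card_spin_cast] at h
    have h1 := loopProb_add G S hu hβ hxy
    rw [h, eq_sub_iff_add_eq'.2 h1]
    field_simp
    ring
  exact ⟨key hxy, key hxy.symm⟩

end Final

end SpinLoop

end

theorem theorem5p2 {Λ : Type*} [Fintype Λ] [DecidableEq Λ] (G : SimpleGraph Λ)
    [DecidableRel G.Adj] (S : ℕ) (u β : ℝ) (hu : u ∈ Set.Icc (0 : ℝ) 1) (hβ : 0 ≤ β)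
    (x y : Λ) (hxy : x ≠ y) :
    SpinLoop.partitionFunction G S u β 0 ≠ 0 ∧
    (∀ A B : SpinLoop.SiteOp S,
      SpinLoop.expect G S u β (SpinLoop.onSite x A * SpinLoop.onSite y B) =
        1 / (2 * (S : ℂ) + 1) * (A * B).trace *
            SpinLoop.loopProb G S u β (SpinLoop.eventPlus G x y) +
        1 / (2 * (S : ℂ) + 1) *
            (∑ a : SpinLoop.Spin S, ∑ b : SpinLoop.Spin S,
              (-1 : ℂ) ^ (a.1 + b.1) * A a b * B a.opp b.opp) *
            SpinLoop.loopProb G S u β (SpinLoop.eventMinus G x y) +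
        1 / (2 * (S : ℂ) + 1) ^ 2 * A.trace * B.trace *
            SpinLoop.loopProb G S u β (SpinLoop.eventSame G x y)ᶜ) ∧
    (∀ i : Fin 3,
      SpinLoop.expect G S u β
          (SpinLoop.onSite x (SpinLoop.spinOp S i) * SpinLoop.onSite y (SpinLoop.spinOp S i)) =
        1 / 3 * (S : ℂ) * ((S : ℂ) + 1) *
          (SpinLoop.loopProb G S u β (SpinLoop.eventPlus G x y) -
            SpinLoop.loopProb G S u β (SpinLoop.eventMinus G x y))) ∧
    (∀ i : Fin 3,
      SpinLoop.expect G S u β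
          (SpinLoop.onSite x (SpinLoop.spinOp S i ^ 2) *
            SpinLoop.onSite y (SpinLoop.spinOp S i ^ 2)) -
        SpinLoop.expect G S u β (SpinLoop.onSite x (SpinLoop.spinOp S i ^ 2)) *
          SpinLoop.expect G S u β (SpinLoop.onSite y (SpinLoop.spinOp S i ^ 2)) =
        1 / 45 * (S : ℂ) * ((S : ℂ) + 1) * (2 * (S : ℂ) - 1) * (2 * (S : ℂ) + 3) *
          SpinLoop.loopProb G S u β (SpinLoop.eventSame G x y)) := by
  have hN := SpinLoop.two_mul_add_one_ne_zero S
  have hadd := SpinLoop.loopProb_add G S hu hβ hxy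
  refine ⟨SpinLoop.partitionFunction_ne_zero G S hu hβ hxy,
    SpinLoop.expect_onSite_mul_onSite G S hu hβ hxy, fun i => ?_, fun i => ?_⟩
  · rw [SpinLoop.expect_onSite_mul_onSite G S hu hβ hxy, SpinLoop.sum_spinOp_opp,
      SpinLoop.trace_spinOp, ← sq, SpinLoop.trace_spinOp_sq]
    field_simp
    ring
  -- The product of single-site means is the coefficient of the disconnected event, so writing its
  -- probability as one minus the others leaves `tr (Sⁱ)⁴ / (2S+1) - (tr (Sⁱ)² / (2S+1))²` in front
  -- of `eventSame`.
  · rw [SpinLoop.expect_onSite_mul_onSite G S hu hβ hxy, SpinLoop.sum_spinOp_sq_opp,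
      (SpinLoop.expect_onSite G S hu hβ hxy _).1, (SpinLoop.expect_onSite G S hu hβ hxy _).2,
      ← pow_add, SpinLoop.trace_spinOp_pow_four, SpinLoop.trace_spinOp_sq,
      SpinLoop.loopProb_eventSame G S hu hβ, eq_sub_iff_add_eq'.2 hadd]
    field_simp
    ring
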